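/- Let $d\ge 2$ and let $f:[0,1)^d\to\mathbb R$ be $d$ times continuously differentiable (with one-sided derivatives at the faces of the cube), such that for some finite $B\ge 0$ and $\beta\in(0,1]$ every partial derivative $g=\partial^d f/\partial x_1^{j_1}\cdots\partial x_d^{j_d}$ with $j_1+\cdots+j_d=d$ satisfies $|g(x)-g(y)|\le B\|x-y\|^\beta$ for all $x,y\in[0,1)^d$ (Euclidean norm). Let $\mu=\int_{[0,1)^d}f(x)\,dx$. For a positive integer $q$ let $A=(a_{i,j})\in \mathrm{OA}(q^2,d,q,2)$, that is, $A$ is a $q^2\times d$ matrix with entries in $\{0,\dots,q-1\}$ such that in any two distinct columns each of the $q^2$ possible rows occurs equally often. Let $\pi_j,\ \pi_{j;s},\ \pi_{i,j,k}$ ($1\le i\le q^2$, $1\le j\le d$, $0\le s\le q-1$, $k\ge 2$) be mutually independent random permutations of $\{0,\dots,q-1\}$, each uniformly distributed over the $q!$ possible values. Let $b_{i,j}\in\{0,\dots,q-1\}$ be labels, deterministic or random but independent of these permutations, such that in each column $j$ the rows $i$ with the same value of $a_{i,j}$ have distinct labels. Put $$X_{i,j}=\sum_{k\ge1}x_{i,j,k}q^{-k},\qquad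 x_{i,j,1}=\pi_j(a_{i,j}),\quad x_{i,j,k}=\pi_{i,j,k}(0)\ (k\ge2),$$ $$Y_{i,j}=\sum_{k\ge1}y_{i,j,k}q^{-k},\qquad y_{i,j,1}=\pi_j(a_{i,j}),\quad y_{i,j,2}=\pi_{j;a_{i,j}}(b_{i,j}),\quad y_{i,j,k}=\pi_{i,j,k}(0)\ (k\ge3),$$ $X_i=(X_{i,1},\dots,X_{i,d})$, $Y_i=(Y_{i,1},\dots,Y_{i,d})$, $\hat\mu_{oas}=q^{-2}\sum_{i=1}^{q^2} f(X_i)$, $\hat\mu_{oal}=q^{-2}\sum_{i=1}^{q^2} f(Y_i)$, $\sigma_{oas}^2=\mathrm{Var}(\hat\mu_{oas})$, $\sigma_{oal}^2=\mathrm{Var}(\hat\mu_{oal})$, $W_{oas}=(\hat\mu_{oas}-\mu)/\sigma_{oas}$ and $W_{oal}=(\hat\mu_{oal}-\mu)/\sigma_{oal}$. For integers $u_1,\dots,u_d\ge0$ and digits $c_{j,k}\in\{0,\dots,q-1\}$ define recursively $$\nu_{u_1,\dots,u_d}[c_{j,1},\dots,c_{j,u_j}:1\le j\le d]=E f(U)-\sum_{u^*\prec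 u}\nu_{u_1^*,\dots,u_d^*}[c_{j,1},\dots,c_{j,u_j^*}:1\le j\le d],$$ where $U$ is uniformly distributed on $\prod_{j=1}^d\big[\sum_{k=1}^{u_j}c_{j,k}q^{-k},\ q^{-u_j}+\sum_{k=1}^{u_j}c_{j,k}q^{-k}\big)$, and $u^*\prec u$ runs over the $u^*\in\{0,1,2,\dots\}^d$ with $u^*_j\le u_j$ for all $j$ and $u^*\ne u$. Let $|u|$ be the number of nonzero coordinates of $u$, and $$S=\sum_{i=1}^{q^2}\ \sum_{u\in\{0,1\}^d:\,|u|\ge3}\nu_{u}[\pi_j(a_{i,j}):\ u_j=1],\qquad \sigma^2=E\{(q^{-2}S)^2\},\qquad W=\frac{1}{q^2\sigma}\,S .$$ Then, along any sequence of positive integers $q\to\infty$ for which such arrays exist and any choice of arrays $A\in\mathrm{OA}(q^2,d,q,2)$, $$q\,(\sigma_{oal}W_{oal}-\sigma W)\to0\qquad\text{and}\qquad q\,(\sigma_{oas}W_{oas}-\sigma W)\to0\qquad\text{in probability.}$$ (If one of $\sigma_{oal},\sigma_{oas},\sigma$ vanishes, the corresponding quotient $W_{oal}$, $W_{oas}$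 or $W$ is read as $0$.) -/

import Mathlib

open MeasureTheory ProbabilityTheory Filter Topology

noncomputable section

namespace OASampling

/-- The half-open unit cube `[0,1)^d`. -/
def cube (d : ℕ) : Set (EuclideanSpace ℝ (Fin d)) :=
  {x | ∀ j, x j ∈ Set.Ico (0 : ℝ) 1}

/-- `f` is smooth on `[0,1)^d` with a Lipschitz continuous mixed partial of order `d`: it is `d` times
continuously differentiable on the cube (one-sided at its faces) and every partial derivative
`∂^d f / ∂x_{s 0} ⋯ ∂x_{s (d-1)}` of order `d` satisfies a Hölder condition with constant `B` and
exponent `β ∈ (0,1]`. Values of `f` off the cube play no role. -/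
def SmoothLipschitzMixedPartial {d : ℕ} (f : EuclideanSpace ℝ (Fin d) → ℝ) : Prop :=
  ContDiffOn ℝ d f (cube d) ∧
    ∃ B β : ℝ, 0 ≤ B ∧ 0 < β ∧ β ≤ 1 ∧
      ∀ s : Fin d → Fin d, ∀ x ∈ cube d, ∀ y ∈ cube d,
        |iteratedFDerivWithin ℝ d f (cube d) x (fun r => EuclideanSpace.single (s r) (1 : ℝ)) -
          iteratedFDerivWithin ℝ d f (cube d) y (fun r => EuclideanSpace.single (s r) (1 : ℝ))|
          ≤ B * ‖x - y‖ ^ β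

/-- The class `OA(n, d, q, t)` of orthogonal arrays of strength `t ≤ d` with `n` rows, `d` columns and
symbols `0, …, q-1`: in every `n × t` submatrix each of the `q^t` possible rows occurs equally often. -/
def IsOrthogonalArray {n d q : ℕ} (t : ℕ) (A : Matrix (Fin n) (Fin d) (Fin q)) : Prop :=
  t ≤ d ∧ ∀ (c : Fin t ↪ Fin d) (v w : Fin t → Fin q),
    (Finset.univ.filter fun i => ∀ s, A i (c s) = v s).card =
      (Finset.univ.filter fun i => ∀ s, A i (c s) = w s).card

instance permMeasurableSpace (q : ℕ) : MeasurableSpace (Equiv.Perm (Fin q)) := ⊤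

/-- Indices of the random permutations of `{0, …, q-1}`. -/
inductive PermIndex (d q : ℕ) : Type
  /-- `π_j`, which randomizes the symbols of column `j`. -/
  | column (j : Fin d)
  /-- `π_{j;s}`, which gives the second digits in the rows whose entry in column `j` is `s`. -/
  | sub (j : Fin d) (s : Fin q)
  /-- `π_{i,j,m+2}`, `m = 0, 1, …`, which gives the digit number `m + 2` of coordinate `j` of
  point `i`. -/
  | digit (i : Fin (q ^ 2)) (j : Fin d) (m : ℕ)

/-- The random objects on `(Ω, P)` from which the designs are built. The permutations `π` are mutually
independent and uniform. The labels `b i j ∈ {0, …, q-1}` are the second base-`q` digits of the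
array `A**`: in each column the rows that share a symbol of `A` carry distinct labels. They may be
random or not, and are independent of the permutations. -/
structure IsRandomization {d q : ℕ} {Ω : Type*} [MeasurableSpace Ω] (P : Measure Ω)
    (A : Matrix (Fin (q ^ 2)) (Fin d) (Fin q))
    (π : PermIndex d q → Ω → Equiv.Perm (Fin q))
    (b : Ω → Fin (q ^ 2) → Fin d → Fin q) : Prop where
  measurable_perm : ∀ r, Measurable (π r)
  uniform_perm : ∀ r τ, P {ω | π r ω = τ} = ((q.factorial : ENNReal))⁻¹
  indep_perm : iIndepFun π P
  measurable_label : Measurable b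
  label_injective : ∀ ω i i' j, A i j = A i' j → b ω i j = b ω i' j → i = i'
  indep_label : IndepFun b (fun ω r => π r ω) P

section Designs

variable {d q : ℕ} {Ω : Type*}

/-- The box of points whose `j`-th coordinate has `c_{j,1}, …, c_{j,u_j}` as its first `u_j` base-`q`
digits. -/
def box (u : Fin d → ℕ) (c : Fin d → ℕ → Fin q) : Set (EuclideanSpace ℝ (Fin d)) :=
  {x | ∀ j, x j ∈ Set.Ico
    (∑ k ∈ Finset.range (u j), ((c j k : ℕ) : ℝ) / (q : ℝ) ^ (k + 1))
    (((q : ℝ) ^ u j)⁻¹ + ∑ k ∈ Finset.range (u j), ((c j k : ℕ) : ℝ) / (q : ℝ) ^ (k + 1))}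

/-- The ANOVA term `ν_{u_1,…,u_d}[c_{j,1}, …, c_{j,u_j} : 1 ≤ j ≤ d]`, defined recursively: the mean
of `f` at a uniform random point of the box, minus the terms of all smaller indices. -/
def nu (f : EuclideanSpace ℝ (Fin d) → ℝ) (c : Fin d → ℕ → Fin q) (u : Fin d → ℕ) : ℝ :=
  (⨍ x in box u c, f x) - ∑ v ∈ (Finset.Iio u).attach, nu f c v.1
termination_by ∑ j, u j
decreasing_by exact Fintype.sum_strictMono (Finset.mem_Iio.mp v.2)

/-- The recursion that defines `nu`. -/
theorem nu_eq (f : EuclideanSpace ℝ (Fin d) → ℝ) (c : Fin d → ℕ → Fin q) (u : Fin d → ℕ) :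
    nu f c u = (⨍ x in box u c, f x) - ∑ v ∈ Finset.Iio u, nu f c v := by
  rw [nu, Finset.sum_attach (Finset.Iio u) (nu f c)]

variable [NeZero q]

/-- The base-`q` digits of the randomized orthogonal array sample; `k = 0` is the first digit. -/
def oasDigit (A : Matrix (Fin (q ^ 2)) (Fin d) (Fin q))
    (π : PermIndex d q → Ω → Equiv.Perm (Fin q)) (ω : Ω) (i : Fin (q ^ 2)) (j : Fin d) : ℕ → Fin q
  | 0 => π (.column j) ω (A i j)
  | m + 1 => π (.digit i j m) ω 0

/-- The base-`q` digits of the OA-based Latin hypercube; `k = 0` is the first digit. -/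
def oalDigit (A : Matrix (Fin (q ^ 2)) (Fin d) (Fin q))
    (π : PermIndex d q → Ω → Equiv.Perm (Fin q)) (b : Ω → Fin (q ^ 2) → Fin d → Fin q)
    (ω : Ω) (i : Fin (q ^ 2)) (j : Fin d) : ℕ → Fin q
  | 0 => π (.column j) ω (A i j)
  | 1 => π (.sub j (A i j)) ω (b ω i j)
  | m + 2 => π (.digit i j (m + 1)) ω 0

/-- The point whose `j`-th coordinate is `∑_{k ≥ 1} c_{j,k} q^{-k}`. -/
def ofDigits (c : Fin d → ℕ → Fin q) : EuclideanSpace ℝ (Fin d) :=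
  WithLp.toLp 2 fun j => ∑' k : ℕ, ((c j k : ℕ) : ℝ) / (q : ℝ) ^ (k + 1)

/-- `μ = ∫_{[0,1)^d} f(x) dx`. -/
def mean (f : EuclideanSpace ℝ (Fin d) → ℝ) : ℝ := ∫ x in cube d, f x

/-- The estimator `q⁻² ∑ᵢ f(Xᵢ)`. -/
def muOas (f : EuclideanSpace ℝ (Fin d) → ℝ) (A : Matrix (Fin (q ^ 2)) (Fin d) (Fin q))
    (π : PermIndex d q → Ω → Equiv.Perm (Fin q)) (ω : Ω) : ℝ :=
  1 / (q : ℝ) ^ 2 * ∑ i, f (ofDigits (oasDigit A π ω i))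

/-- The estimator `q⁻² ∑ᵢ f(Yᵢ)`. -/
def muOal (f : EuclideanSpace ℝ (Fin d) → ℝ) (A : Matrix (Fin (q ^ 2)) (Fin d) (Fin q))
    (π : PermIndex d q → Ω → Equiv.Perm (Fin q)) (b : Ω → Fin (q ^ 2) → Fin d → Fin q)
    (ω : Ω) : ℝ :=
  1 / (q : ℝ) ^ 2 * ∑ i, f (ofDigits (oalDigit A π b ω i))

/-- `∑ᵢ ∑_u ν_u[π_j(a_{i,j}) : 1 ≤ j ≤ d]` over `u ∈ {0,1}^d` with at least three nonzero coordinates.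
Such terms depend on the first digits only. -/
def proxySum (f : EuclideanSpace ℝ (Fin d) → ℝ) (A : Matrix (Fin (q ^ 2)) (Fin d) (Fin q))
    (π : PermIndex d q → Ω → Equiv.Perm (Fin q)) (ω : Ω) : ℝ :=
  ∑ i, ∑ u ∈ (Finset.Iic (1 : Fin d → ℕ)).filter
      (fun u => 3 ≤ (Finset.univ.filter fun j => 1 ≤ u j).card),
    nu f (fun j _ => π (.column j) ω (A i j)) u

variable [MeasurableSpace Ω]

/-- The standard deviation of `muOas`. -/
def sigmaOas (P : Measure Ω) (f : EuclideanSpace ℝ (Fin d) → ℝ)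
    (A : Matrix (Fin (q ^ 2)) (Fin d) (Fin q))
    (π : PermIndex d q → Ω → Equiv.Perm (Fin q)) : ℝ :=
  √(variance (muOas f A π) P)

/-- The standard deviation of `muOal`. -/
def sigmaOal (P : Measure Ω) (f : EuclideanSpace ℝ (Fin d) → ℝ)
    (A : Matrix (Fin (q ^ 2)) (Fin d) (Fin q))
    (π : PermIndex d q → Ω → Equiv.Perm (Fin q)) (b : Ω → Fin (q ^ 2) → Fin d → Fin q) : ℝ :=
  √(variance (muOal f A π b) P)

/-- `σ`, the root of the second moment of `q⁻²` times `proxySum`. -/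
def sigma (P : Measure Ω) (f : EuclideanSpace ℝ (Fin d) → ℝ)
    (A : Matrix (Fin (q ^ 2)) (Fin d) (Fin q))
    (π : PermIndex d q → Ω → Equiv.Perm (Fin q)) : ℝ :=
  √(∫ ω, (1 / (q : ℝ) ^ 2 * proxySum f A π ω) ^ 2 ∂P)

def WOas (P : Measure Ω) (f : EuclideanSpace ℝ (Fin d) → ℝ)
    (A : Matrix (Fin (q ^ 2)) (Fin d) (Fin q))
    (π : PermIndex d q → Ω → Equiv.Perm (Fin q)) (ω : Ω) : ℝ :=
  (muOas f A π ω - mean f) / sigmaOas P f A π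

def WOal (P : Measure Ω) (f : EuclideanSpace ℝ (Fin d) → ℝ)
    (A : Matrix (Fin (q ^ 2)) (Fin d) (Fin q))
    (π : PermIndex d q → Ω → Equiv.Perm (Fin q)) (b : Ω → Fin (q ^ 2) → Fin d → Fin q)
    (ω : Ω) : ℝ :=
  (muOal f A π b ω - mean f) / sigmaOal P f A π b

/-- The proxy statistic `W`. -/
def WProxy (P : Measure Ω) (f : EuclideanSpace ℝ (Fin d) → ℝ)
    (A : Matrix (Fin (q ^ 2)) (Fin d) (Fin q))
    (π : PermIndex d q → Ω → Equiv.Perm (Fin q)) (ω : Ω) : ℝ :=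
  1 / ((q : ℝ) ^ 2 * sigma P f A π) * proxySum f A π ω

end Designs

/-- Convergence to `0` in probability, for random variables that may live on different spaces. -/
def TendstoZeroInProbability {Ω : ℕ → Type*} [∀ n, MeasurableSpace (Ω n)]
    (P : ∀ n, Measure (Ω n)) (Z : ∀ n, Ω n → ℝ) : Prop :=
  ∀ ε : ℝ, 0 < ε → Tendsto (fun n => P n {ω | ε ≤ |Z n ω|}) atTop (𝓝 0)

end OASampling

end

open OASampling

noncomputable section

namespace OASampling

/-! Smoothness enters through one consequence: `f` is Lipschitz on the cube
(`SmoothLipschitzMixedPartial.exists_lipschitz`). Almost surely each sample point lies in the box of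
its first two digits. That box has diameter of order `q⁻¹ ^ 2`, so replacing `f` by its mean over
the box costs `O(q⁻²)`. This mean is then split into the mean over the larger box of the first
digits and a deviation of size `O(q⁻¹)`.

The first-digit part is exact: summed over the rows, the ANOVA terms of order one and two cancel
because any two columns run through all pairs of symbols once, so what remains is `mean f` plus
`q⁻²` times the proxy sum (`proxySum_eq`).

The deviations are centred given the first digits. Two rows share at most one permutation for their
second digits. If they share none, their deviations are uncorrelated. If they share one, it is
evaluated at distinct labels, and sampling without replacement makes the covariance `O(q⁻² / (q -
1))` (`abs_sum_draw_mul_draw_le`). A row has at most `d (q - 1)` such partners, so the covariances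
add up to the order of the variances (`IsDrawScheme.sum_sq_le`), and the average of the `q²`
deviations has second moment `O(q⁻⁴)`. After multiplication by `q` this is `O(q⁻²)`, and Markov's
inequality concludes (`IsDesign.measure_le_abs_le`).

Both designs are instances of `IsDesign`. A vanishing variance is harmless because the bias of the
estimator is itself `O(q⁻²)`. -/

/-! ### The cube, and Lipschitz continuity from bounded derivatives -/

theorem convex_cube (d : ℕ) : Convex ℝ (cube d) := by
  intro x hx y hy a b ha hb hab j
  have h := (convex_Ico (0 : ℝ) 1) (hx j) (hy j) ha hb hab
  simpa using h

theorem zero_mem_cube (d : ℕ) : (0 : EuclideanSpace ℝ (Fin d)) ∈ cube d := by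
  intro j; simp

/-- A convex set with an interior point, here the centre, determines one-sided derivatives at its
faces. -/
theorem uniqueDiffOn_cube (d : ℕ) : UniqueDiffOn ℝ (cube d) := by
  refine uniqueDiffOn_convex (convex_cube d) ⟨WithLp.toLp 2 fun _ => 1 / 2, ?_⟩
  rw [mem_interior]
  refine ⟨⋂ j, (fun x : EuclideanSpace ℝ (Fin d) => x j) ⁻¹' Set.Ioo 0 1, ?_, ?_, ?_⟩
  · intro x hx j
    have := Set.mem_iInter.1 hx j
    exact ⟨this.1.le, this.2⟩
  · exact isOpen_iInter_of_finite fun j => isOpen_Ioo.preimage (by fun_prop)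
  · simp only [Set.mem_iInter, Set.mem_preimage, Set.mem_Ioo]
    intro j
    norm_num

theorem norm_le_of_mem_cube {d : ℕ} {x : EuclideanSpace ℝ (Fin d)} (hx : x ∈ cube d) :
    ‖x‖ ≤ √d := by
  rw [EuclideanSpace.norm_eq]
  apply Real.sqrt_le_sqrt
  calc ∑ j, ‖x j‖ ^ 2 ≤ ∑ _j : Fin d, (1 : ℝ) := by
        refine Finset.sum_le_sum fun j _ => ?_
        have h := hx j
        rw [Real.norm_of_nonneg h.1]
        nlinarith [h.1, h.2]
    _ = d := by simp

/-- A multilinear form on Euclidean space is bounded by its values on basis vectors. -/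
theorem norm_multilinear_le_of_basis {d m : ℕ}
    (M : ContinuousMultilinearMap ℝ (fun _ : Fin m => EuclideanSpace ℝ (Fin d)) ℝ) (C : ℝ)
    (hC : 0 ≤ C)
    (h : ∀ s : Fin m → Fin d, |M (fun r => EuclideanSpace.single (s r) (1 : ℝ))| ≤ C) :
    ‖M‖ ≤ (Fintype.card (Fin m → Fin d)) * C := by
  classical
  refine M.opNorm_le_bound (by positivity) fun v => ?_
  have hv : v = fun r => ∑ j, v r j • EuclideanSpace.single j (1 : ℝ) := by
    funext r
    ext i
    simp [Pi.single_apply]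
  have h1 : M v = ∑ s : Fin m → Fin d,
      (∏ r, v r (s r)) • M (fun r => EuclideanSpace.single (s r) (1 : ℝ)) := by
    conv_lhs => rw [hv]
    rw [M.map_sum]
    refine Finset.sum_congr rfl fun s _ => ?_
    exact M.map_smul_univ (fun r => v r (s r)) _
  rw [h1]
  calc ‖∑ s : Fin m → Fin d,
      (∏ r, v r (s r)) • M (fun r => EuclideanSpace.single (s r) (1 : ℝ))‖
      ≤ ∑ s : Fin m → Fin d, C * ∏ r, ‖v r‖ := by
        refine norm_sum_le_of_le _ fun s _ => ?_
        rw [norm_smul, norm_prod, mul_comm]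
        refine mul_le_mul (h s) ?_ (by positivity) hC
        exact Finset.prod_le_prod (fun _ _ => norm_nonneg _)
          fun r _ => PiLp.norm_apply_le (v r) (s r)
    _ = _ := by simp [mul_assoc]

/-- Mean value inequality on a convex set; it lets a bound descend from order `k + 1` to order `k`.
-/
theorem iteratedFDerivWithin_lipschitz {d k : ℕ} {f : EuclideanSpace ℝ (Fin d) → ℝ}
    (hf : ContDiffOn ℝ d f (cube d)) (hk : k < d) {C : ℝ}
    (hC : ∀ x ∈ cube d, ‖iteratedFDerivWithin ℝ (k + 1) f (cube d) x‖ ≤ C)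
    {x y : EuclideanSpace ℝ (Fin d)} (hx : x ∈ cube d) (hy : y ∈ cube d) :
    ‖iteratedFDerivWithin ℝ k f (cube d) y - iteratedFDerivWithin ℝ k f (cube d) x‖
      ≤ C * ‖y - x‖ := by
  refine (convex_cube d).norm_image_sub_le_of_norm_fderivWithin_le (𝕜 := ℝ) ?_ (fun z hz => ?_) hx hy
  · exact hf.differentiableOn_iteratedFDerivWithin (by exact_mod_cast hk) (uniqueDiffOn_cube d)
  · rw [norm_fderivWithin_iteratedFDerivWithin]
    exact hC z hz

/-- A function on the cube with bounded derivatives of order `d` is Lipschitz there. -/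
theorem SmoothLipschitzMixedPartial.exists_lipschitz {d : ℕ} {f : EuclideanSpace ℝ (Fin d) → ℝ}
    (hf : SmoothLipschitzMixedPartial f) (hd : 1 ≤ d) :
    ∃ L : ℝ, 0 ≤ L ∧ ∀ x ∈ cube d, ∀ y ∈ cube d, |f x - f y| ≤ L * ‖x - y‖ := by
  obtain ⟨hc, B, β, hB, hβ, -, hH⟩ := hf
  have top : ∃ C, ∀ x ∈ cube d, ‖iteratedFDerivWithin ℝ d f (cube d) x‖ ≤ C := by
    -- The Hölder condition compares the derivative at `x` with the one at the corner `0`, at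
    -- distance at most `√d`.
    refine ⟨‖iteratedFDerivWithin ℝ d f (cube d) 0‖ +
      Fintype.card (Fin d → Fin d) * (B * √d ^ β), fun x hx => ?_⟩
    have h := norm_multilinear_le_of_basis (iteratedFDerivWithin ℝ d f (cube d) x -
      iteratedFDerivWithin ℝ d f (cube d) 0) (B * √d ^ β) (by positivity) (fun s => by
        refine (hH s x hx 0 (zero_mem_cube d)).trans ?_
        rw [sub_zero]
        gcongr
        exact norm_le_of_mem_cube hx)
    have := norm_le_norm_add_norm_sub' (iteratedFDerivWithin ℝ d f (cube d) x)
      (iteratedFDerivWithin ℝ d f (cube d) 0)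
    linarith
  have bdd : ∃ C, ∀ x ∈ cube d, ‖iteratedFDerivWithin ℝ 1 f (cube d) x‖ ≤ C := by
    -- Boundedness descends from order `d` to order `1`, each time anchored at the corner `0`.
    refine Nat.decreasingInduction' (P := fun k =>
      ∃ C, ∀ x ∈ cube d, ‖iteratedFDerivWithin ℝ k f (cube d) x‖ ≤ C) ?_ hd top
    rintro k hk - ⟨C, hC⟩
    refine ⟨‖iteratedFDerivWithin ℝ k f (cube d) 0‖ + C * √d, fun x hx => ?_⟩
    have h := iteratedFDerivWithin_lipschitz hc hk hC (zero_mem_cube d) hx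
    have hC0 : 0 ≤ C := (norm_nonneg _).trans (hC x hx)
    have h2 : C * ‖x - 0‖ ≤ C * √d := by
      rw [sub_zero]
      exact mul_le_mul_of_nonneg_left (norm_le_of_mem_cube hx) hC0
    have := norm_le_norm_add_norm_sub' (iteratedFDerivWithin ℝ k f (cube d) x)
      (iteratedFDerivWithin ℝ k f (cube d) 0)
    linarith
  obtain ⟨C, hC⟩ := bdd
  refine ⟨C, (norm_nonneg _).trans (hC 0 (zero_mem_cube d)), fun x hx y hy => ?_⟩
  have h := iteratedFDerivWithin_lipschitz (k := 0) hc (by omega) (by simpa using hC) hy hx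
  rw [iteratedFDerivWithin_zero_eq_comp] at h
  simpa only [Function.comp, ← map_sub, LinearIsometryEquiv.norm_map, Real.norm_eq_abs] using h

/-! ### Covariances of digits drawn from uniform permutations -/

section Permutations

variable {T : Type*} [Fintype T] [DecidableEq T] {d q : ℕ} [NeZero q]

/-- The digits that the permutations `τ` assign to the labels `β` through the index map `κ`. -/
def draw (κ : Fin d → T) (β : Fin d → Fin q) (τ : T → Equiv.Perm (Fin q)) : Fin d → Fin q :=
  fun j => τ (κ j) (β j)

/-- Shifting the permutations at the indices `κ j`, `j ∈ J`, leaves sums over all permutations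
unchanged; if `D` averages to zero along these shifts, so does its product with anything that
the shifts do not affect. -/
theorem sum_draw_mul_eq_zero (κ : Fin d → T) (hκ : Function.Injective κ) (β : Fin d → Fin q)
    (J : Finset (Fin d)) (D : (Fin d → Fin q) → ℝ)
    (hD : ∀ e : Fin d → Fin q, ∑ t : Fin d → Fin q, D (fun j => if j ∈ J then t j + e j else e j) = 0)
    (G : (T → Equiv.Perm (Fin q)) → ℝ)
    (hG : ∀ K τ, (∀ r, (∀ j ∈ J, κ j ≠ r) → K r = 1) → G (K * τ) = G τ) :
    ∑ τ, D (draw κ β τ) * G τ = 0 := by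
  -- Composing with a translation of `Fin q` permutes the summation range and shifts the drawn
  -- digit; the other permutations stay fixed.
  let K : (Fin d → Fin q) → T → Equiv.Perm (Fin q) := fun t =>
    Function.extend κ (fun j => if j ∈ J then Equiv.addLeft (t j) else 1) 1
  have hKG : ∀ t τ, G (K t * τ) = G τ := by
    intro t τ
    refine hG _ _ fun r hr => ?_
    by_cases h : ∃ j, κ j = r
    · obtain ⟨j, rfl⟩ := h
      have : j ∉ J := fun hj => hr j hj rfl
      simp [K, hκ.extend_apply, this]
    · simp [K, Function.extend_apply' _ _ _ h]
  have hKD : ∀ t τ, draw κ β (K t * τ) =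
      fun j => if j ∈ J then t j + draw κ β τ j else draw κ β τ j := by
    intro t τ
    funext j
    simp only [draw, Pi.mul_apply, K, hκ.extend_apply]
    split_ifs <;> simp
  have h1 : ∀ t : Fin d → Fin q, ∑ τ, D (draw κ β τ) * G τ =
      ∑ τ, D (fun j => if j ∈ J then t j + draw κ β τ j else draw κ β τ j) * G τ := by
    intro t
    rw [← Equiv.sum_comp (Equiv.mulLeft (K t))]
    simp [hKG, hKD]
  -- Averaging over all shifts makes the inner sum vanish for each fixed `τ`.
  have h2 : (Fintype.card (Fin d → Fin q) : ℝ) * ∑ τ, D (draw κ β τ) * G τ = 0 := by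
    rw [← nsmul_eq_mul, ← Finset.card_univ, ← Finset.sum_const,
      Finset.sum_congr rfl fun t _ => h1 t, Finset.sum_comm]
    refine Finset.sum_eq_zero fun τ _ => ?_
    rw [← Finset.sum_mul, hD, zero_mul]
  have : (Fintype.card (Fin d → Fin q) : ℝ) ≠ 0 := by
    exact_mod_cast Fintype.card_ne_zero
  exact (mul_eq_zero.1 h2).resolve_left this

theorem sum_add_left (D : (Fin d → Fin q) → ℝ) (e : Fin d → Fin q) :
    ∑ t : Fin d → Fin q, D (fun j => t j + e j) = ∑ t, D t :=
  Equiv.sum_comp (Equiv.addRight e) D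

/-- Writing the new value as `e j + s` turns each fixed `s` into a translation of the whole range.
-/
theorem sum_sum_update (F : (Fin d → Fin q) → ℝ) (j : Fin d) :
    ∑ e, ∑ s, F (Function.update e j s) = q * ∑ e, F e := by
  have : ∀ s : Fin q, ∑ e, F (Function.update e j (e j + s)) = ∑ e, F e := by
    intro s
    have h := Equiv.sum_comp (Equiv.addRight (Pi.single j s : Fin d → Fin q)) F
    rw [← h]
    refine Finset.sum_congr rfl fun e _ => congrArg F ?_
    funext k
    by_cases hk : k = j
    · subst hk; simp
    · simp [hk]
  calc ∑ e, ∑ s, F (Function.update e j s)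
      = ∑ e, ∑ s, F (Function.update e j (e j + s)) :=
        Finset.sum_congr rfl fun e _ =>
          (Equiv.sum_comp (Equiv.addLeft (e j)) fun s => F (Function.update e j s)).symm
    _ = ∑ s : Fin q, ∑ e, F e := by
        rw [Finset.sum_comm]; exact Finset.sum_congr rfl fun s _ => this s
    _ = _ := by simp

theorem sum_draw_eq_zero (κ : Fin d → T) (hκ : Function.Injective κ) (β : Fin d → Fin q)
    (D : (Fin d → Fin q) → ℝ) (hD : ∑ e, D e = 0) : ∑ τ, D (draw κ β τ) = 0 := by
  simpa using sum_draw_mul_eq_zero κ hκ β Finset.univ D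
    (by intro e; simpa [hD] using sum_add_left D e) (fun _ => 1) (by simp)

/-- Draws without a common permutation are uncorrelated. -/
theorem sum_draw_mul_draw_of_disjoint (κ κ' : Fin d → T) (hκ : Function.Injective κ)
    (β β' : Fin d → Fin q) (hdis : ∀ j j', κ j ≠ κ' j') (D D' : (Fin d → Fin q) → ℝ)
    (hD : ∑ e, D e = 0) : ∑ τ, D (draw κ β τ) * D' (draw κ' β' τ) = 0 := by
  refine sum_draw_mul_eq_zero κ hκ β Finset.univ D
    (by intro e; simpa [hD] using sum_add_left D e) _ fun K τ hK => congrArg D' ?_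
  funext j
  simp [draw, hK (κ' j) fun i _ => hdis i j]

/-- Draws that share a single permutation, evaluated at distinct labels, have a covariance smaller
than the product of their ranges by a factor `q - 1`. -/
theorem abs_sum_draw_mul_draw_le (κ κ' : Fin d → T) (hκ : Function.Injective κ)
    (hκ' : Function.Injective κ') (β β' : Fin d → Fin q) (j₀ : Fin d) (h₀ : κ j₀ = κ' j₀)
    (hβ : β j₀ ≠ β' j₀) (hdis : ∀ j j', κ j = κ' j' → j = j₀)
    (D D' : (Fin d → Fin q) → ℝ) (hD : ∑ e, D e = 0) {w : ℝ}
    (hw : ∀ e, |D e| ≤ w) (hw' : ∀ e, |D' e| ≤ w) :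
    ((q : ℝ) - 1) * |∑ τ, D (draw κ β τ) * D' (draw κ' β' τ)| ≤
      Fintype.card (T → Equiv.Perm (Fin q)) * w ^ 2 := by
  set S : Fin q → ℝ := fun b =>
    ∑ τ, D (draw κ (Function.update β j₀ b) τ) * D' (draw κ' β' τ) with hS
  have hSβ : S (β j₀) = ∑ τ, D (draw κ β τ) * D' (draw κ' β' τ) := by
    simp [hS]
  have hswap : ∀ b, b ≠ β' j₀ → S b = S (β j₀) := by
    intro b hb
    simp only [hS]
    -- Exchanging the labels `b` and `β j₀` before the shared permutation acts leaves `β' j₀` alone,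
    -- so the second factor does not change.
    rw [← Equiv.sum_comp (Equiv.mulRight (Pi.mulSingle (κ j₀) (Equiv.swap b (β j₀))))]
    refine Finset.sum_congr rfl fun τ _ => ?_
    congr 2
    · funext j
      by_cases hj : j = j₀
      · subst hj; simp [draw]
      · simp [draw, hj, Pi.mulSingle_eq_of_ne (hκ.ne hj)]
    · funext j
      by_cases hj : j = j₀
      · subst hj
        simp [draw, ← h₀, Equiv.swap_apply_of_ne_of_ne hb.symm hβ.symm]
      · have : κ' j ≠ κ j₀ := by rw [h₀]; exact hκ'.ne hj
        simp [draw, Pi.mulSingle_eq_of_ne this]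
  have hsum : ∑ b, S b = 0 := by
    -- Summing over all labels at `j₀` sums over all values of the shared digit; the remaining
    -- coordinates involve no permutation of the second draw and can be averaged out.
    have h := sum_draw_mul_eq_zero κ hκ β (Finset.univ.erase j₀)
      (fun e => ∑ y, D (Function.update e j₀ y)) (by
        intro e
        have h1 := sum_sum_update D j₀
        rw [hD, mul_zero, ← sum_add_left _ e] at h1
        rw [← h1]
        refine Finset.sum_congr rfl fun t _ => Finset.sum_congr rfl fun s _ => congrArg D ?_
        funext k
        by_cases hk : k = j₀
        · subst hk; simp
        · simp [hk]) (fun τ => D' (draw κ' β' τ)) (by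
        intro K τ hK
        refine congrArg D' ?_
        funext j
        have : K (κ' j) = 1 := hK _ fun i hi h => (Finset.ne_of_mem_erase hi) (hdis i j h)
        simp [draw, this])
    rw [← h]
    simp only [hS]
    rw [Finset.sum_comm]
    refine Finset.sum_congr rfl fun τ _ => ?_
    rw [Finset.sum_mul]
    refine Eq.trans ?_ (Equiv.sum_comp (τ (κ j₀)) _)
    refine Finset.sum_congr rfl fun b _ => ?_
    congr 2
    funext j
    by_cases hj : j = j₀
    · subst hj; simp [draw]
    · simp [draw, hj]
  have hbound : |S (β' j₀)| ≤ Fintype.card (T → Equiv.Perm (Fin q)) * w ^ 2 := by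
    refine (Finset.abs_sum_le_sum_abs _ _).trans ?_
    rw [← nsmul_eq_mul, ← Finset.card_univ, ← Finset.sum_const]
    refine Finset.sum_le_sum fun τ _ => ?_
    rw [abs_mul, sq]
    exact mul_le_mul (hw _) (hw' _) (abs_nonneg _) ((abs_nonneg _).trans (hw fun _ => 0))
  -- The sum over all labels vanishes, `q - 1` of its terms are equal, and the last one, with
  -- coinciding labels, has only the trivial bound.
  have heq : ((q : ℝ) - 1) * S (β j₀) = - S (β' j₀) := by
    rw [← Finset.add_sum_erase _ _ (Finset.mem_univ (β' j₀)),
      Finset.sum_congr rfl fun b hb => hswap b (Finset.ne_of_mem_erase hb)] at hsum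
    have hq : 1 ≤ q := Nat.one_le_iff_ne_zero.2 (NeZero.ne q)
    rw [Finset.sum_const, Finset.card_erase_of_mem (Finset.mem_univ _), Finset.card_univ,
      Fintype.card_fin, nsmul_eq_mul, Nat.cast_sub hq, Nat.cast_one] at hsum
    linarith
  have hq : (0 : ℝ) ≤ (q : ℝ) - 1 := by
    have : (1 : ℝ) ≤ q := by exact_mod_cast Nat.one_le_iff_ne_zero.2 (NeZero.ne q)
    linarith
  rw [← hSβ, ← abs_of_nonneg hq, ← abs_mul, heq, abs_neg]
  exact hbound

/-- How the digits of `n` points are drawn from permutations: two points share at most one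
permutation, in the same column and at distinct labels, and each permutation is shared by at
most `q` points. -/
structure IsDrawScheme {n : ℕ} (κ : Fin n → Fin d → T) (β : Fin n → Fin d → Fin q) : Prop where
  injective : ∀ i, Function.Injective (κ i)
  column_eq : ∀ i i' j j', κ i j = κ i' j' → j = j'
  shared_unique : ∀ i i' j k, i ≠ i' → κ i j = κ i' j → κ i k = κ i' k → j = k
  label_ne : ∀ i i' j, i ≠ i' → κ i j = κ i' j → β i j ≠ β i' j
  card_shared_le : ∀ i j, ((Finset.univ.erase i).filter fun i' => κ i j = κ i' j).card ≤ q - 1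

/-- Each row contributes `1` from its diagonal term and at most `1` per column from its partners, in
units of `w ^ 2`: at most `q - 1` partners, each with covariance at most `w ^ 2 / (q - 1)`. -/
theorem IsDrawScheme.sum_sq_le {n : ℕ} {κ : Fin n → Fin d → T} {β : Fin n → Fin d → Fin q}
    (h : IsDrawScheme κ β) (hq : 2 ≤ q) (D : Fin n → (Fin d → Fin q) → ℝ)
    (hD : ∀ i, ∑ e, D i e = 0) {w : ℝ} (hw : ∀ i e, |D i e| ≤ w) :
    ∑ τ, (∑ i, D i (draw (κ i) (β i) τ)) ^ 2 ≤
      Fintype.card (T → Equiv.Perm (Fin q)) * (n * ((1 + d) * w ^ 2)) := by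
  set N : ℝ := ((Fintype.card (T → Equiv.Perm (Fin q)) : ℕ) : ℝ) with hN
  set c : Fin n → Fin n → ℝ := fun i i' =>
    ∑ τ, D i (draw (κ i) (β i) τ) * D i' (draw (κ i') (β i') τ) with hc
  have hq1 : (0 : ℝ) < (q : ℝ) - 1 := by
    have : (2 : ℝ) ≤ q := by exact_mod_cast hq
    linarith
  have hexp : ∑ τ, (∑ i, D i (draw (κ i) (β i) τ)) ^ 2 = ∑ i, ∑ i', c i i' := by
    simp only [sq, Finset.sum_mul_sum, hc]
    rw [Finset.sum_comm]
    exact Finset.sum_congr rfl fun i _ => Finset.sum_comm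
  have hdiag : ∀ i, c i i ≤ N * w ^ 2 := by
    intro i
    rw [hN, ← nsmul_eq_mul, ← Finset.card_univ, ← Finset.sum_const]
    refine Finset.sum_le_sum fun τ _ => ?_
    rw [← sq, ← sq_abs]
    exact pow_le_pow_left₀ (abs_nonneg _) (hw i _) 2
  have hoff : ∀ i i', i ≠ i' →
      c i i' ≤ ∑ j, if κ i j = κ i' j then N * w ^ 2 / ((q : ℝ) - 1) else 0 := by
    intro i i' hi
    by_cases hs : ∃ j, κ i j = κ i' j
    · obtain ⟨j, hj⟩ := hs
      have h1 := abs_sum_draw_mul_draw_le (κ i) (κ i') (h.injective i) (h.injective i') (β i)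
        (β i') j hj (h.label_ne i i' j hi hj) (fun k k' hk => by
          obtain rfl := h.column_eq i i' k k' hk
          exact h.shared_unique i i' k j hi hk hj) (D i) (D i') (hD i) (hw i) (hw i')
      calc c i i' ≤ N * w ^ 2 / ((q : ℝ) - 1) := by
            rw [le_div_iff₀ hq1, mul_comm]
            exact (mul_le_mul_of_nonneg_left (le_abs_self _) hq1.le).trans h1
        _ = if κ i j = κ i' j then N * w ^ 2 / ((q : ℝ) - 1) else 0 := by rw [if_pos hj]
        _ ≤ _ := Finset.single_le_sum
            (f := fun j => if κ i j = κ i' j then N * w ^ 2 / ((q : ℝ) - 1) else 0)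
            (fun k _ => by split_ifs <;> positivity) (Finset.mem_univ j)
    · push Not at hs
      have h1 := sum_draw_mul_draw_of_disjoint (κ i) (κ i') (h.injective i) (β i) (β i')
        (fun j j' hjj => by
          obtain rfl := h.column_eq i i' j j' hjj
          exact hs _ hjj) (D i) (D i') (hD i)
      simp [hc, h1, hs]
  have hrow : ∀ i, ∑ i', c i i' ≤ N * ((1 + d) * w ^ 2) := by
    intro i
    rw [← Finset.add_sum_erase _ _ (Finset.mem_univ i)]
    have h2 : ∑ i' ∈ Finset.univ.erase i, c i i' ≤ d * (N * w ^ 2) := by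
      calc ∑ i' ∈ Finset.univ.erase i, c i i'
          ≤ ∑ i' ∈ Finset.univ.erase i, ∑ j,
              if κ i j = κ i' j then N * w ^ 2 / ((q : ℝ) - 1) else 0 :=
            Finset.sum_le_sum fun i' hi' => hoff i i' (Finset.ne_of_mem_erase hi').symm
        _ = ∑ j, ∑ i' ∈ Finset.univ.erase i,
              if κ i j = κ i' j then N * w ^ 2 / ((q : ℝ) - 1) else 0 := Finset.sum_comm
        _ ≤ ∑ _j : Fin d, N * w ^ 2 := by
            refine Finset.sum_le_sum fun j _ => ?_
            rw [← Finset.sum_filter, Finset.sum_const, nsmul_eq_mul]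
            have h3 : ((((Finset.univ.erase i).filter fun i' => κ i j = κ i' j).card : ℕ) : ℝ)
                ≤ (q : ℝ) - 1 := by
              have := h.card_shared_le i j
              rw [← Nat.cast_one, ← Nat.cast_sub (by omega)]
              exact_mod_cast this
            calc _ ≤ ((q : ℝ) - 1) * (N * w ^ 2 / ((q : ℝ) - 1)) := by gcongr
              _ = N * w ^ 2 := by field_simp
        _ = d * (N * w ^ 2) := by simp
    have := hdiag i
    linarith
  rw [hexp]
  calc ∑ i, ∑ i', c i i' ≤ ∑ _i : Fin n, N * ((1 + d) * w ^ 2) :=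
        Finset.sum_le_sum fun i _ => hrow i
    _ = _ := by simp; ring

end Permutations

/-! ### Digit boxes, means over them, and points given by digits -/

section Boxes

variable {d q : ℕ}

/-- The real numbers whose first `m` base-`q` digits are those of `c`. -/
def digitIco (m : ℕ) (c : ℕ → Fin q) : Set ℝ :=
  Set.Ico (∑ k ∈ Finset.range m, ((c k : ℕ) : ℝ) / (q : ℝ) ^ (k + 1))
    (((q : ℝ) ^ m)⁻¹ + ∑ k ∈ Finset.range m, ((c k : ℕ) : ℝ) / (q : ℝ) ^ (k + 1))

theorem measurableSet_digitIco (m : ℕ) (c : ℕ → Fin q) : MeasurableSet (digitIco m c) :=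
  measurableSet_Ico

theorem mem_box {u : Fin d → ℕ} {c : Fin d → ℕ → Fin q} {x : EuclideanSpace ℝ (Fin d)} :
    x ∈ box u c ↔ ∀ j, x j ∈ digitIco (u j) (c j) := Iff.rfl

theorem digitIco_congr {m : ℕ} {c c' : ℕ → Fin q} (h : ∀ k < m, c k = c' k) :
    digitIco m c = digitIco m c' := by
  have : ∑ k ∈ Finset.range m, ((c k : ℕ) : ℝ) / (q : ℝ) ^ (k + 1) =
      ∑ k ∈ Finset.range m, ((c' k : ℕ) : ℝ) / (q : ℝ) ^ (k + 1) :=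
    Finset.sum_congr rfl fun k hk => by rw [h k (Finset.mem_range.1 hk)]
  rw [digitIco, digitIco, this]

theorem box_congr {u : Fin d → ℕ} {c c' : Fin d → ℕ → Fin q}
    (h : ∀ j, ∀ k < u j, c j k = c' j k) : box u c = box u c' := by
  ext x
  simp only [mem_box]
  exact forall_congr' fun j => by rw [digitIco_congr (h j)]

variable [NeZero q]

theorem cast_base_pos : (0 : ℝ) < q := by
  exact_mod_cast Nat.pos_of_ne_zero (NeZero.ne q)

/-- The next digit is the integer part of the rescaled remainder; since it is at most `q - 1`, the
subinterval stays inside its parent. -/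
theorem digitIco_succ_iff {m : ℕ} {c : ℕ → Fin q} {x : ℝ} :
    x ∈ digitIco (m + 1) c ↔ x ∈ digitIco m c ∧ ((c m : ℕ) : ℝ) ≤
      (x - ∑ k ∈ Finset.range m, ((c k : ℕ) : ℝ) / (q : ℝ) ^ (k + 1)) * (q : ℝ) ^ (m + 1) ∧
      (x - ∑ k ∈ Finset.range m, ((c k : ℕ) : ℝ) / (q : ℝ) ^ (k + 1)) * (q : ℝ) ^ (m + 1) <
        (c m : ℕ) + 1 := by
  have hq : (0 : ℝ) < q := cast_base_pos
  have hp : (0 : ℝ) < (q : ℝ) ^ (m + 1) := by positivity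
  have hc : ((c m : ℕ) : ℝ) + 1 ≤ q := by exact_mod_cast (c m).2
  have hpm : ((q : ℝ) ^ m)⁻¹ = q / (q : ℝ) ^ (m + 1) := by
    rw [pow_succ]; field_simp
  rw [digitIco, digitIco, Finset.sum_range_succ, hpm]
  set S := ∑ k ∈ Finset.range m, ((c k : ℕ) : ℝ) / (q : ℝ) ^ (k + 1)
  simp only [Set.mem_Ico]
  rw [← div_le_iff₀ hp, ← lt_div_iff₀ hp, add_div, ← one_div]
  have h1 : 0 ≤ ((c m : ℕ) : ℝ) / (q : ℝ) ^ (m + 1) := by positivity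
  have h2 : (((c m : ℕ) : ℝ) + 1) / (q : ℝ) ^ (m + 1) ≤ q / (q : ℝ) ^ (m + 1) := by gcongr
  rw [add_div] at h2
  constructor
  · rintro ⟨h3, h4⟩
    refine ⟨⟨?_, ?_⟩, ?_, ?_⟩ <;> linarith
  · rintro ⟨⟨h3, h4⟩, h5, h6⟩
    constructor <;> linarith

theorem digitIco_anti {m n : ℕ} (h : m ≤ n) (c : ℕ → Fin q) : digitIco n c ⊆ digitIco m c := by
  induction n, h using Nat.le_induction with
  | base => exact subset_rfl
  | succ n _ ih => exact fun x hx => ih (digitIco_succ_iff.1 hx).1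

theorem box_anti {u v : Fin d → ℕ} (h : u ≤ v) (c : Fin d → ℕ → Fin q) : box v c ⊆ box u c :=
  fun _ hx j => digitIco_anti (h j) (c j) (hx j)

omit [NeZero q] in
theorem box_zero (c : Fin d → ℕ → Fin q) : box 0 c = cube d := by
  simp [box, cube]

theorem box_subset_cube (u : Fin d → ℕ) (c : Fin d → ℕ → Fin q) : box u c ⊆ cube d := by
  rw [← box_zero c]
  exact box_anti (fun _ => Nat.zero_le _) c

/-- Refining one digit splits an interval into `q` parts. -/
theorem digitIco_eq_iUnion (m : ℕ) (c : ℕ → Fin q) :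
    digitIco m c = ⋃ s, digitIco (m + 1) (Function.update c m s) := by
  have hq : (0 : ℝ) < q := cast_base_pos
  have hupd : ∀ s, ∀ k < m, Function.update c m s k = c k := fun s k hk =>
    Function.update_of_ne hk.ne _ _
  ext x
  simp only [Set.mem_iUnion, digitIco_succ_iff, Function.update_self]
  have hsum : ∀ s, ∑ k ∈ Finset.range m, ((Function.update c m s k : ℕ) : ℝ) / (q : ℝ) ^ (k + 1) =
      ∑ k ∈ Finset.range m, ((c k : ℕ) : ℝ) / (q : ℝ) ^ (k + 1) := fun s =>
    Finset.sum_congr rfl fun k hk => by rw [hupd s k (Finset.mem_range.1 hk)]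
  simp only [digitIco_congr (hupd _), hsum]
  refine ⟨fun hx => ?_, fun ⟨s, hs⟩ => hs.1⟩
  set t := (x - ∑ k ∈ Finset.range m, ((c k : ℕ) : ℝ) / (q : ℝ) ^ (k + 1)) * (q : ℝ) ^ (m + 1)
    with ht
  have hx' := hx
  rw [digitIco, Set.mem_Ico] at hx'
  have ht0 : 0 ≤ t := mul_nonneg (by linarith [hx'.1]) (by positivity)
  have htq : t < q := by
    have h1 : x - ∑ k ∈ Finset.range m, ((c k : ℕ) : ℝ) / (q : ℝ) ^ (k + 1) < ((q : ℝ) ^ m)⁻¹ := by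
      linarith [hx'.2]
    calc t < ((q : ℝ) ^ m)⁻¹ * (q : ℝ) ^ (m + 1) := by
          rw [ht]
          exact mul_lt_mul_of_pos_right h1 (by positivity)
      _ = q := by rw [pow_succ]; field_simp
  exact ⟨⟨⌊t⌋₊, (Nat.floor_lt ht0).2 htq⟩, hx, Nat.floor_le ht0, Nat.lt_floor_add_one t⟩

theorem box_eq_iUnion (u : Fin d → ℕ) (c : Fin d → ℕ → Fin q) (j : Fin d) :
    box u c = ⋃ s, box (Function.update u j (u j + 1))
      (Function.update c j (Function.update (c j) (u j) s)) := by
  ext x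
  simp only [mem_box, Set.mem_iUnion]
  constructor
  · intro h
    have hj := h j
    rw [digitIco_eq_iUnion] at hj
    obtain ⟨s, hs⟩ := Set.mem_iUnion.1 hj
    refine ⟨s, fun k => ?_⟩
    by_cases hk : k = j
    · subst hk; simpa using hs
    · simpa [hk] using h k
  · rintro ⟨s, hs⟩ k
    by_cases hk : k = j
    · subst hk
      rw [digitIco_eq_iUnion]
      exact Set.mem_iUnion.2 ⟨s, by simpa using hs k⟩
    · simpa [hk] using hs k

theorem pairwise_disjoint_box (u : Fin d → ℕ) (c : Fin d → ℕ → Fin q) (j : Fin d) :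
    Pairwise (Function.onFun Disjoint fun s => box (Function.update u j (u j + 1))
      (Function.update c j (Function.update (c j) (u j) s))) := by
  intro s s' hne
  rw [Function.onFun, Set.disjoint_left]
  intro x hx hx'
  apply hne
  have h := digitIco_succ_iff.1 (by simpa using mem_box.1 hx j)
  have h' := digitIco_succ_iff.1 (by simpa using mem_box.1 hx' j)
  have hsum : ∀ s, ∑ k ∈ Finset.range (u j),
      ((Function.update (c j) (u j) s k : ℕ) : ℝ) / (q : ℝ) ^ (k + 1) =
      ∑ k ∈ Finset.range (u j), ((c j k : ℕ) : ℝ) / (q : ℝ) ^ (k + 1) := fun s =>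
    Finset.sum_congr rfl fun k hk => by
      rw [Function.update_of_ne (Finset.mem_range.1 hk).ne]
  rw [hsum, Function.update_self] at h h'
  have h1 : ((s : ℕ) : ℝ) < (s' : ℕ) + 1 := h.2.1.trans_lt h'.2.2
  have h2 : ((s' : ℕ) : ℝ) < (s : ℕ) + 1 := h'.2.1.trans_lt h.2.2
  have h3 : (s : ℕ) < s' + 1 := by exact_mod_cast h1
  have h4 : (s' : ℕ) < s + 1 := by exact_mod_cast h2
  exact Fin.ext (by omega)

omit [NeZero q] in
theorem box_eq_preimage (u : Fin d → ℕ) (c : Fin d → ℕ → Fin q) :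
    box u c = WithLp.ofLp ⁻¹' Set.univ.pi fun j => digitIco (u j) (c j) := by
  ext x; simp [mem_box]

omit [NeZero q] in
theorem measurableSet_box (u : Fin d → ℕ) (c : Fin d → ℕ → Fin q) : MeasurableSet (box u c) := by
  rw [box_eq_preimage]
  exact (PiLp.volume_preserving_ofLp (Fin d)).measurable
    (MeasurableSet.univ_pi fun j => measurableSet_digitIco _ _)

omit [NeZero q] in
theorem volume_real_box (u : Fin d → ℕ) (c : Fin d → ℕ → Fin q) :
    (volume : Measure (EuclideanSpace ℝ (Fin d))).real (box u c) = ∏ j, ((q : ℝ) ^ u j)⁻¹ := by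
  rw [box_eq_preimage, (PiLp.volume_preserving_ofLp (Fin d)).measureReal_preimage
    (MeasurableSet.univ_pi fun j => measurableSet_digitIco _ _).nullMeasurableSet,
    measureReal_def]
  unfold digitIco
  rw [Real.volume_pi_Ico_toReal]
  · simp
  · intro j
    simp

theorem volume_real_box_pos (u : Fin d → ℕ) (c : Fin d → ℕ → Fin q) :
    0 < (volume : Measure (EuclideanSpace ℝ (Fin d))).real (box u c) := by
  have : (0 : ℝ) < q := cast_base_pos
  rw [volume_real_box]
  positivity

/-- The mean of `f` over a box. -/
def boxMean (f : EuclideanSpace ℝ (Fin d) → ℝ) (u : Fin d → ℕ) (c : Fin d → ℕ → Fin q) : ℝ :=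
  ⨍ x in box u c, f x

omit [NeZero q] in
theorem boxMean_congr (f : EuclideanSpace ℝ (Fin d) → ℝ) {u : Fin d → ℕ}
    {c c' : Fin d → ℕ → Fin q} (h : ∀ j, ∀ k < u j, c j k = c' j k) :
    boxMean f u c = boxMean f u c' := by
  rw [boxMean, box_congr h, boxMean]

omit [NeZero q] in
theorem boxMean_eq (f : EuclideanSpace ℝ (Fin d) → ℝ) (u : Fin d → ℕ) (c : Fin d → ℕ → Fin q) :
    boxMean f u c = (∏ j, (q : ℝ) ^ u j) * ∫ x in box u c, f x := by
  rw [boxMean, setAverage_eq, volume_real_box, smul_eq_mul, ← Finset.prod_inv_distrib]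
  simp

omit [NeZero q] in
theorem boxMean_zero (f : EuclideanSpace ℝ (Fin d) → ℝ) (c : Fin d → ℕ → Fin q) :
    boxMean f 0 c = mean f := by
  rw [boxMean_eq, box_zero, mean]; simp

/-- The `q` boxes obtained by refining one digit are disjoint, fill the parent and have equal
volume. -/
theorem sum_boxMean_update {f : EuclideanSpace ℝ (Fin d) → ℝ} (hf : IntegrableOn f (cube d))
    (u : Fin d → ℕ) (c : Fin d → ℕ → Fin q) (j : Fin d) :
    ∑ s, boxMean f (Function.update u j (u j + 1))
      (Function.update c j (Function.update (c j) (u j) s)) = q * boxMean f u c := by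
  simp_rw [boxMean_eq]
  rw [← Finset.mul_sum, ← integral_iUnion_fintype (fun s => measurableSet_box _ _)
    (pairwise_disjoint_box u c j) (fun s => hf.mono_set (box_subset_cube _ _)),
    ← box_eq_iUnion, ← mul_assoc]
  congr 1
  rw [← Finset.mul_prod_erase _ _ (Finset.mem_univ j),
    ← Finset.mul_prod_erase _ (fun k => (q : ℝ) ^ u k) (Finset.mem_univ j), Function.update_self,
    pow_succ', mul_assoc]
  congr 2
  refine Finset.prod_congr rfl fun k hk => ?_
  rw [Function.update_of_ne (Finset.ne_of_mem_erase hk)]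

/-- The digits `c`, continued by `e` after the first `u j` digits. -/
def extendDigits (u : Fin d → ℕ) (c : Fin d → ℕ → Fin q) (e : Fin d → Fin q) :
    Fin d → ℕ → Fin q :=
  fun j k => if k < u j then c j k else e j

/-- The coordinates are refined one at a time. This is what centres the deviations of the second
digits. -/
theorem sum_boxMean_extendDigits {f : EuclideanSpace ℝ (Fin d) → ℝ}
    (hf : IntegrableOn f (cube d)) (u : Fin d → ℕ) (c : Fin d → ℕ → Fin q) :
    ∑ e, boxMean f (u + 1) (extendDigits u c e) =
      Fintype.card (Fin d → Fin q) * boxMean f u c := by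
  classical
  have hq : (q : ℝ) ≠ 0 := cast_base_pos.ne'
  have key : ∀ J : Finset (Fin d), ∑ e, boxMean f (fun j => if j ∈ J then u j + 1 else u j)
      (extendDigits u c e) = Fintype.card (Fin d → Fin q) * boxMean f u c := by
    intro J
    induction J using Finset.induction_on with
    | empty =>
      have h : ∀ e, boxMean f u (extendDigits u c e) = boxMean f u c := fun e =>
        boxMean_congr f fun j k hk => by simp [extendDigits, hk]
      simp [h]
    | insert j J hj ih =>
      -- The factor `q` pays for summing the new digit of coordinate `j` separately from `e`.
      rw [← ih, ← mul_right_inj' hq, ← sum_sum_update _ j, Finset.mul_sum]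
      refine Finset.sum_congr rfl fun e _ => ?_
      rw [← sum_boxMean_update hf _ _ j]
      refine Finset.sum_congr rfl fun s _ => ?_
      have hv : (fun i => if i ∈ insert j J then u i + 1 else u i) =
          Function.update (fun i => if i ∈ J then u i + 1 else u i) j (u j + 1) := by
        funext i
        by_cases hi : i = j
        · subst hi; simp
        · simp [hi]
      rw [hv]
      simp only [if_neg hj]
      refine boxMean_congr f fun i k hk => ?_
      by_cases hi : i = j
      · subst hi
        simp only [Function.update_self] at hk ⊢
        by_cases hk' : k = u i
        · subst hk'; simp [extendDigits]
        · have : k < u i := by omega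
          simp [extendDigits, this, hk']
      · simp [extendDigits, hi]
  have := key Finset.univ
  simpa [Pi.add_def] using this

theorem norm_sub_le_of_mem_box {m : ℕ} {c : Fin d → ℕ → Fin q} {x y : EuclideanSpace ℝ (Fin d)}
    (hx : x ∈ box (fun _ => m) c) (hy : y ∈ box (fun _ => m) c) :
    ‖x - y‖ ≤ √d * ((q : ℝ) ^ m)⁻¹ := by
  have hq : (0 : ℝ) < q := cast_base_pos
  rw [EuclideanSpace.norm_eq, ← Real.sqrt_sq (show (0 : ℝ) ≤ ((q : ℝ) ^ m)⁻¹ by positivity),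
    ← Real.sqrt_mul (Nat.cast_nonneg d)]
  apply Real.sqrt_le_sqrt
  calc ∑ j, ‖(x - y) j‖ ^ 2 ≤ ∑ _j : Fin d, (((q : ℝ) ^ m)⁻¹) ^ 2 := by
        refine Finset.sum_le_sum fun j _ => ?_
        have h1 := hx j
        have h2 := hy j
        rw [Set.mem_Ico] at h1 h2
        refine pow_le_pow_left₀ (norm_nonneg _) ?_ 2
        rw [Real.norm_eq_abs, PiLp.sub_apply, abs_le]
        constructor <;> linarith [h1.1, h1.2, h2.1, h2.2]
    _ = _ := by simp

/-- A closed ball is convex, so it contains the average of values lying in it. -/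
theorem abs_boxMean_sub_le {f : EuclideanSpace ℝ (Fin d) → ℝ} (hf : IntegrableOn f (cube d))
    {u : Fin d → ℕ} {c : Fin d → ℕ → Fin q} {a r : ℝ} (h : ∀ x ∈ box u c, |f x - a| ≤ r) :
    |boxMean f u c - a| ≤ r := by
  have hpos := volume_real_box_pos u c
  rw [measureReal_def, ENNReal.toReal_pos_iff] at hpos
  have := (convex_closedBall a r).set_average_mem (μ := volume) (t := box u c) (f := f)
    Metric.isClosed_closedBall hpos.1.ne' hpos.2.ne
    ((ae_restrict_iff' (measurableSet_box u c)).2 (Eventually.of_forall fun x hx => by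
      simpa [Metric.mem_closedBall, Real.dist_eq] using h x hx))
    (hf.mono_set (box_subset_cube u c))
  rwa [Metric.mem_closedBall, Real.dist_eq] at this

section Lipschitz

variable {f : EuclideanSpace ℝ (Fin d) → ℝ} {L : ℝ}

theorem continuousOn_of_lipschitz
    (hL : ∀ x ∈ cube d, ∀ y ∈ cube d, |f x - f y| ≤ L * ‖x - y‖) : ContinuousOn f (cube d) :=
  (LipschitzOnWith.of_dist_le_mul (K := L.toNNReal) fun x hx y hy => by
    rw [Real.dist_eq, dist_eq_norm]
    exact (hL x hx y hy).trans (by gcongr; exact Real.le_coe_toNNReal L)).continuousOn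

theorem measurableSet_cube (d : ℕ) : MeasurableSet (cube d) := by
  rw [← box_zero (q := 1) fun _ _ => 0]
  exact measurableSet_box _ _

theorem abs_le_of_lipschitz (hL0 : 0 ≤ L)
    (hL : ∀ x ∈ cube d, ∀ y ∈ cube d, |f x - f y| ≤ L * ‖x - y‖)
    {x : EuclideanSpace ℝ (Fin d)} (hx : x ∈ cube d) : |f x| ≤ |f 0| + L * √d := by
  have h1 := hL x hx 0 (zero_mem_cube d)
  have h2 : L * ‖x - 0‖ ≤ L * √d := by
    rw [sub_zero]
    exact mul_le_mul_of_nonneg_left (norm_le_of_mem_cube hx) hL0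
  have := abs_sub_abs_le_abs_sub (f x) (f 0)
  linarith

theorem integrableOn_of_lipschitz (hL0 : 0 ≤ L)
    (hL : ∀ x ∈ cube d, ∀ y ∈ cube d, |f x - f y| ≤ L * ‖x - y‖) : IntegrableOn f (cube d) := by
  have hfin : volume (cube d) < ⊤ := by
    have := volume_real_box_pos (q := 1) (d := d) 0 fun _ _ => 0
    rw [box_zero, measureReal_def, ENNReal.toReal_pos_iff] at this
    exact this.2
  have : IsFiniteMeasure (volume.restrict (cube d)) := ⟨by simpa using hfin⟩
  refine Integrable.of_bound ((continuousOn_of_lipschitz hL).aestronglyMeasurable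
    (measurableSet_cube d)) (|f 0| + L * √d) ?_
  exact (ae_restrict_iff' (measurableSet_cube d)).2
    (Eventually.of_forall fun x hx => abs_le_of_lipschitz hL0 hL hx)

theorem abs_sub_boxMean_le (hL0 : 0 ≤ L)
    (hL : ∀ x ∈ cube d, ∀ y ∈ cube d, |f x - f y| ≤ L * ‖x - y‖) {m : ℕ}
    {c : Fin d → ℕ → Fin q} {y : EuclideanSpace ℝ (Fin d)} (hy : y ∈ box (fun _ => m) c) :
    |f y - boxMean f (fun _ => m) c| ≤ L * (√d * ((q : ℝ) ^ m)⁻¹) := by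
  rw [abs_sub_comm]
  refine abs_boxMean_sub_le (integrableOn_of_lipschitz hL0 hL) fun x hx => ?_
  refine (hL x (box_subset_cube _ _ hx) y (box_subset_cube _ _ hy)).trans ?_
  exact mul_le_mul_of_nonneg_left (norm_sub_le_of_mem_box hx hy) hL0

theorem abs_boxMean_sub_boxMean_le (hL0 : 0 ≤ L)
    (hL : ∀ x ∈ cube d, ∀ y ∈ cube d, |f x - f y| ≤ L * ‖x - y‖) {m n : ℕ} (hmn : m ≤ n)
    (c : Fin d → ℕ → Fin q) :
    |boxMean f (fun _ => n) c - boxMean f (fun _ => m) c| ≤ L * (√d * ((q : ℝ) ^ m)⁻¹) :=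
  abs_boxMean_sub_le (integrableOn_of_lipschitz hL0 hL) fun _ hx =>
    abs_sub_boxMean_le hL0 hL (box_anti (fun _ => hmn) c hx)

end Lipschitz

/-- Termwise comparison with the expansion whose digits are all `q - 1`, which sums to `1`; the
inequality is strict at `k`. -/
theorem ofDigits_lt_one {c : ℕ → Fin q} {k : ℕ} (hk : (c k : ℕ) + 1 < q) :
    Real.ofDigits c < 1 := by
  have hq : 1 < q := by omega
  rw [← Real.ofDigits_const_last_eq_one' hq]
  have hle : ∀ n, (c n : ℕ) ≤ q - 1 := fun n => Nat.le_sub_one_of_lt (c n).2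
  have hq0 : (0 : ℝ) < q := cast_base_pos
  refine Summable.tsum_lt_tsum (i := k) (fun n => ?_) ?_ Real.summable_ofDigitsTerm
    Real.summable_ofDigitsTerm
  · simp only [Real.ofDigitsTerm]
    gcongr
    exact hle n
  · simp only [Real.ofDigitsTerm]
    gcongr
    show (c k : ℕ) < q - 1
    omega

omit [NeZero q] in
theorem ofDigits_apply (c : Fin d → ℕ → Fin q) (j : Fin d) :
    ofDigits c j = Real.ofDigits (c j) := rfl

/-- Digits that are not eventually `q - 1` give a point of the box of their first digits. -/
theorem ofDigits_mem_box {u : Fin d → ℕ} {c : Fin d → ℕ → Fin q}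
    (h : ∀ j, ∃ k, u j ≤ k ∧ (c j k : ℕ) + 1 < q) : ofDigits c ∈ box u c := by
  intro j
  have hq : (0 : ℝ) < q := cast_base_pos
  obtain ⟨k, hk, hlt⟩ := h j
  rw [ofDigits_apply, Real.ofDigits_eq_sum_add_ofDigits _ (u j)]
  have h0 := Real.ofDigits_nonneg fun i => c j (i + u j)
  have h1 : Real.ofDigits (fun i => c j (i + u j)) < 1 :=
    ofDigits_lt_one (k := k - u j) (by rwa [Nat.sub_add_cancel hk])
  simp only [Real.ofDigitsTerm, ← div_eq_mul_inv]
  have hp : (0 : ℝ) < ((q : ℝ) ^ u j)⁻¹ := by positivity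
  constructor
  · have := mul_nonneg hp.le h0
    linarith
  · have := mul_lt_of_lt_one_right hp h1
    linarith

omit [NeZero q] in
theorem measurable_ofDigits_comp {Ω : Type*} [MeasurableSpace Ω] {c : Ω → Fin d → ℕ → Fin q}
    (hc : ∀ j k, Measurable fun ω => c ω j k) : Measurable fun ω => ofDigits (c ω) := by
  refine (WithLp.measurable_toLp 2 (Fin d → ℝ)).comp (measurable_pi_lambda _ fun j => ?_)
  exact Real.continuous_ofDigits.measurable.comp (measurable_pi_lambda _ fun k => hc j k)

end Boxes

/-! ### Orthogonal arrays of strength two with `q²` rows -/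

section Arrays

variable {d q : ℕ}

/-- Rows of an orthogonal array of strength two and index one agree in at most one column. -/
theorem IsOrthogonalArray.row_eq {A : Matrix (Fin (q ^ 2)) (Fin d) (Fin q)}
    (hA : IsOrthogonalArray 2 A) {j k : Fin d} (hjk : j ≠ k) {i i' : Fin (q ^ 2)}
    (h1 : A i j = A i' j) (h2 : A i k = A i' k) : i = i' := by
  classical
  let c : Fin 2 ↪ Fin d := ⟨![j, k], by
    intro a b hab
    fin_cases a <;> fin_cases b <;> simp_all⟩
  let v₀ : Fin 2 → Fin q := fun s => A i (c s)
  have hsum := Finset.card_eq_sum_card_fiberwise (s := (Finset.univ : Finset (Fin (q ^ 2))))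
    (t := (Finset.univ : Finset (Fin 2 → Fin q))) (f := fun i s => A i (c s)) (by simp)
  have hcard : ∀ v, (Finset.univ.filter fun i => (fun s => A i (c s)) = v).card =
      (Finset.univ.filter fun i => (fun s => A i (c s)) = v₀).card := by
    intro v
    simpa only [funext_iff] using hA.2 c v v₀
  rw [Finset.sum_congr rfl fun v _ => hcard v, Finset.sum_const] at hsum
  simp only [Finset.card_univ, Fintype.card_fin, Fintype.card_fun, smul_eq_mul] at hsum
  have hpos : 0 < q ^ 2 := i.pos
  -- Equal multiplicities of `q ^ 2` pairs among `q ^ 2` rows force multiplicity one.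
  have hone : (Finset.univ.filter fun i => (fun s => A i (c s)) = v₀).card ≤ 1 :=
    le_of_mul_le_mul_left (by rw [← hsum, mul_one]) hpos
  refine Finset.card_le_one.1 hone i ?_ i' ?_
  · simp [v₀]
  · simp only [Finset.mem_filter, Finset.mem_univ, true_and, v₀]
    funext s
    fin_cases s
    · exact h1.symm
    · exact h2.symm

theorem IsOrthogonalArray.sum_pair {A : Matrix (Fin (q ^ 2)) (Fin d) (Fin q)}
    (hA : IsOrthogonalArray 2 A) {j k : Fin d} (hjk : j ≠ k) (F : Fin q → Fin q → ℝ) :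
    ∑ i, F (A i j) (A i k) = ∑ s, ∑ t, F s t := by
  have hbij : Function.Bijective fun i => (A i j, A i k) := by
    rw [Fintype.bijective_iff_injective_and_card]
    refine ⟨fun i i' h => ?_, by simp [sq]⟩
    rw [Prod.mk.injEq] at h
    exact hA.row_eq hjk h.1 h.2
  rw [← Fintype.sum_prod_type']
  exact hbij.sum_comp fun p => F p.1 p.2

/-- In a column, at most `q - 1` other rows carry the symbol of a given row. -/
theorem IsOrthogonalArray.card_agree_le {A : Matrix (Fin (q ^ 2)) (Fin d) (Fin q)}
    (hA : IsOrthogonalArray 2 A) (i : Fin (q ^ 2)) (j : Fin d) :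
    ((Finset.univ.erase i).filter fun i' => A i j = A i' j).card ≤ q - 1 := by
  obtain ⟨k, hk⟩ : ∃ k, k ≠ j := by
    have : Nontrivial (Fin d) := Fin.nontrivial_iff_two_le.2 hA.1
    exact exists_ne j
  have : (Finset.univ.filter fun i' => A i j = A i' j).card ≤ q := by
    refine (Finset.card_le_card_of_injOn (t := (Finset.univ : Finset (Fin q)))
      (fun i' => A i' k) (by simp) ?_).trans (by simp)
    intro a ha b hb hab
    simp only [Finset.coe_filter, Finset.mem_univ, true_and, Set.mem_ofPred_eq] at ha hb
    exact hA.row_eq hk hab (ha.symm.trans hb)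
  rw [Finset.filter_erase, Finset.card_erase_of_mem (by simp)]
  omega

end Arrays

/-! ### Cancellation of the low-order ANOVA terms -/

section Anova

variable {d q : ℕ}

theorem sum_Iic_nu (f : EuclideanSpace ℝ (Fin d) → ℝ) (c : Fin d → ℕ → Fin q) (u : Fin d → ℕ) :
    ∑ v ∈ Finset.Iic u, nu f c v = boxMean f u c := by
  rw [← Finset.Iio_insert u, Finset.sum_insert (by simp), nu_eq, boxMean]
  ring

variable [NeZero q] {f : EuclideanSpace ℝ (Fin d) → ℝ}

/-- With `v j = 0` the digit is not read and the terms are equal; with `v j = 1` they are the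
children of one box, and only the first entry of the constant sequence is read. -/
theorem sum_boxMean_update_const (hf : IntegrableOn f (cube d)) {v : Fin d → ℕ}
    (c : Fin d → ℕ → Fin q) {j : Fin d} (hv : v j ≤ 1) :
    ∑ s, boxMean f v (Function.update c j fun _ => s) =
      q * boxMean f (Function.update v j 0) c := by
  obtain h | h : v j = 0 ∨ v j = 1 := by omega
  · rw [← h, Function.update_eq_self]
    have : ∀ s : Fin q, boxMean f v (Function.update c j fun _ => s) = boxMean f v c := by
      refine fun s => boxMean_congr f fun l k hk => ?_
      have : l ≠ j := by rintro rfl; omega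
      simp [this]
    simp [this]
  · rw [← sum_boxMean_update hf _ c j]
    have : Function.update (Function.update v j 0) j (Function.update v j 0 j + 1) = v := by
      simp [← h]
    rw [this]
    refine Finset.sum_congr rfl fun s _ => boxMean_congr f fun l k hk => ?_
    by_cases hl : l = j
    · subst hl
      have : k = 0 := by omega
      simp [this]
    · simp [hl]

/-- At most two coordinates are constrained, and over the rows their symbols form the full grid, so
the boxes tile the cube. -/
theorem sum_boxMean_array (hf : IntegrableOn f (cube d))
    {A : Matrix (Fin (q ^ 2)) (Fin d) (Fin q)} (hA : IsOrthogonalArray 2 A)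
    (σ : Fin d → Equiv.Perm (Fin q)) {v : Fin d → ℕ} (hv1 : v ≤ 1)
    (hv : (Finset.univ.filter fun j => 1 ≤ v j).card ≤ 2) :
    ∑ i, boxMean f v (fun j _ => σ j (A i j)) = (q : ℝ) ^ 2 * mean f := by
  -- Smaller supports are padded to exactly two columns, which exist because strength two includes
  -- `2 ≤ d`.
  obtain ⟨t, hts, htc⟩ := Finset.exists_superset_card_eq hv (by simpa using hA.1)
  obtain ⟨j, k, hjk, rfl⟩ := Finset.card_eq_two.1 htc
  have h0 : ∀ l, l ≠ j → l ≠ k → v l = 0 := by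
    intro l hlj hlk
    by_contra h
    have : l ∈ ({j, k} : Finset (Fin d)) := hts (by simp; omega)
    simp [hlj, hlk] at this
  let c₀ : Fin d → ℕ → Fin q := fun _ _ => 0
  have h1 : ∀ i, boxMean f v (fun j _ => σ j (A i j)) =
      boxMean f v (Function.update (Function.update c₀ j fun _ => σ j (A i j)) k
        fun _ => σ k (A i k)) := by
    refine fun i => boxMean_congr f fun l m hm => ?_
    by_cases hlk : l = k
    · subst hlk; simp
    · by_cases hlj : l = j
      · subst hlj; simp [hlk]
      · rw [h0 l hlj hlk] at hm
        omega
  rw [Finset.sum_congr rfl fun i _ => h1 i, hA.sum_pair hjk fun s t =>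
    boxMean f v (Function.update (Function.update c₀ j fun _ => σ j s) k fun _ => σ k t),
    Equiv.sum_comp (σ j) fun s => ∑ t,
      boxMean f v (Function.update (Function.update c₀ j fun _ => s) k fun _ => σ k t)]
  have h2 : ∀ s, ∑ t, boxMean f v (Function.update (Function.update c₀ j fun _ => s) k
      fun _ => σ k t) =
      q * boxMean f (Function.update v k 0) (Function.update c₀ j fun _ => s) := fun s => by
    rw [Equiv.sum_comp (σ k) fun t =>
      boxMean f v (Function.update (Function.update c₀ j fun _ => s) k fun _ => t)]
    exact sum_boxMean_update_const hf _ (hv1 k)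
  rw [Finset.sum_congr rfl fun s _ => h2 s, ← Finset.mul_sum,
    sum_boxMean_update_const hf _ (by simpa [hjk] using hv1 j)]
  have h3 : Function.update (Function.update v k 0) j 0 = 0 := by
    funext l
    by_cases hlj : l = j
    · subst hlj; simp
    · by_cases hlk : l = k
      · subst hlk; simp [hlj]
      · simp [hlj, hlk, h0 l hlj hlk]
  rw [h3, boxMean_zero]
  ring

/-- The terms of order one and two cancel over an orthogonal array of strength two. -/
theorem sum_nu_array (hf : IntegrableOn f (cube d))
    {A : Matrix (Fin (q ^ 2)) (Fin d) (Fin q)} (hA : IsOrthogonalArray 2 A)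
    (σ : Fin d → Equiv.Perm (Fin q)) (v : Fin d → ℕ) (hv1 : v ≤ 1)
    (hv : (Finset.univ.filter fun j => 1 ≤ v j).card ≤ 2) :
    ∑ i, nu f (fun j _ => σ j (A i j)) v = if v = 0 then (q : ℝ) ^ 2 * mean f else 0 := by
  induction v using WellFoundedLT.induction with
  | ind v ih =>
    have hlow : ∀ w ∈ Finset.Iio v, ∑ i, nu f (fun j _ => σ j (A i j)) w =
        if w = 0 then (q : ℝ) ^ 2 * mean f else 0 := by
      intro w hw
      rw [Finset.mem_Iio] at hw
      refine ih w hw (hw.le.trans hv1) (le_trans (Finset.card_le_card ?_) hv)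
      intro l hl
      simp only [Finset.mem_filter, Finset.mem_univ, true_and] at hl ⊢
      exact hl.trans (hw.le l)
    simp_rw [nu_eq f _ v]
    -- Below a nonzero `v` only the index `0` survives, and it cancels the total of the box means.
    rw [Finset.sum_sub_distrib, Finset.sum_comm, Finset.sum_congr rfl hlow,
      Finset.sum_ite_eq' (Finset.Iio v) 0]
    have hG := sum_boxMean_array hf hA σ hv1 hv
    simp only [boxMean] at hG
    rw [hG]
    by_cases h : v = 0
    · simp [h]
    · have : (0 : Fin d → ℕ) < v := lt_of_le_of_ne (fun _ => Nat.zero_le _) (Ne.symm h)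
      simp [h, this]

variable {Ω : Type*}

/-- The ANOVA terms below `1` add up to the first-digit box mean; removing those of order at most
two removes only `mean f` per row on average. -/
theorem proxySum_eq (hf : IntegrableOn f (cube d))
    {A : Matrix (Fin (q ^ 2)) (Fin d) (Fin q)} (hA : IsOrthogonalArray 2 A)
    (π : PermIndex d q → Ω → Equiv.Perm (Fin q)) (ω : Ω) :
    proxySum f A π ω =
      ∑ i, boxMean f 1 (fun j _ => π (.column j) ω (A i j)) - (q : ℝ) ^ 2 * mean f := by
  simp_rw [← sum_Iic_nu f _ 1]
  rw [proxySum, eq_sub_iff_add_eq]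
  simp_rw [← Finset.sum_filter_add_sum_filter_not (Finset.Iic (1 : Fin d → ℕ))
    fun u => 3 ≤ (Finset.univ.filter fun j => 1 ≤ u j).card]
  rw [Finset.sum_add_distrib]
  congr 1
  have h : ∀ u ∈ (Finset.Iic (1 : Fin d → ℕ)).filter
      (fun u => ¬ 3 ≤ (Finset.univ.filter fun j => 1 ≤ u j).card),
      ∑ i, nu f (fun j _ => π (.column j) ω (A i j)) u =
        if u = 0 then (q : ℝ) ^ 2 * mean f else 0 := by
    intro u hu
    rw [Finset.mem_filter, Finset.mem_Iic] at hu
    exact sum_nu_array hf hA (fun j => π (.column j) ω) u hu.1 (by omega)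
  rw [Finset.sum_comm, Finset.sum_congr rfl h, Finset.sum_ite_eq' _ 0]
  simp

end Anova

/-! ### Expectations as finite averages over labels and permutations -/

section Law

variable {d q : ℕ} {Ω : Type*} [MeasurableSpace Ω] {P : Measure Ω} [IsProbabilityMeasure P]
  {π : PermIndex d q → Ω → Equiv.Perm (Fin q)} {Λ : Type*} [Fintype Λ] [MeasurableSpace Λ]
  [MeasurableSingletonClass Λ] {B : Ω → Λ}

/-- The permutations `π` are independent and uniform, and independent of the labels `B`. -/
structure IsUniformFamily (P : Measure Ω) (π : PermIndex d q → Ω → Equiv.Perm (Fin q))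
    (B : Ω → Λ) : Prop where
  measurable_perm : ∀ r, Measurable (π r)
  uniform_perm : ∀ r τ, P {ω | π r ω = τ} = ((q.factorial : ENNReal))⁻¹
  indep_perm : iIndepFun π P
  measurable_label : Measurable B
  indep_label : IndepFun B (fun ω r => π r ω) P

namespace IsUniformFamily

variable {ι : Type*} [Fintype ι] [DecidableEq ι] {φ : ι → PermIndex d q}

omit [Fintype Λ] [IsProbabilityMeasure P] [DecidableEq ι] [MeasurableSingletonClass Λ] in
theorem measure_perm_eq (h : IsUniformFamily P π B) (hφ : Function.Injective φ)
    (τ : ι → Equiv.Perm (Fin q)) :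
    P ((fun ω r => π (φ r) ω) ⁻¹' {τ}) = ((q.factorial : ENNReal))⁻¹ ^ Fintype.card ι := by
  have h1 := (h.indep_perm.precomp hφ).measure_inter_preimage_eq_mul Finset.univ
    (sets := fun r => {τ r}) (fun r _ => MeasurableSpace.measurableSet_top)
  have h2 : (fun ω r => π (φ r) ω) ⁻¹' {τ} =
      ⋂ r ∈ (Finset.univ : Finset ι), (π (φ r)) ⁻¹' {τ r} := by
    ext ω
    simp [funext_iff]
  have h3 : ∀ r, P (π (φ r) ⁻¹' {τ r}) = ((q.factorial : ENNReal))⁻¹ := fun r =>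
    h.uniform_perm (φ r) (τ r)
  rw [h2, h1, Finset.prod_congr rfl fun r _ => h3 r, Finset.prod_const,
    Finset.card_univ]

omit [Fintype Λ] [IsProbabilityMeasure P] in
theorem measureReal_eq (h : IsUniformFamily P π B) (hφ : Function.Injective φ) (β : Λ)
    (τ : ι → Equiv.Perm (Fin q)) :
    P.real ((fun ω => (B ω, fun r => π (φ r) ω)) ⁻¹' {(β, τ)}) =
      P.real (B ⁻¹' {β}) * ((Fintype.card (ι → Equiv.Perm (Fin q)) : ℕ) : ℝ)⁻¹ := by
  have hi : IndepFun B (fun ω r => π (φ r) ω) P :=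
    h.indep_label.comp measurable_id (ψ := fun (x : PermIndex d q → Equiv.Perm (Fin q)) r => x (φ r))
      (by fun_prop)
  have h1 := hi.measure_inter_preimage_eq_mul {β} {τ} (measurableSet_singleton _)
    (measurableSet_singleton _)
  have h2 : (fun ω => (B ω, fun r => π (φ r) ω)) ⁻¹' {(β, τ)} =
      B ⁻¹' {β} ∩ (fun ω r => π (φ r) ω) ⁻¹' {τ} := by
    ext ω
    simp
  rw [measureReal_def, h2, h1, h.measure_perm_eq hφ, ENNReal.toReal_mul, measureReal_def]
  simp [Fintype.card_perm]

omit [Fintype Λ] [IsProbabilityMeasure P] [DecidableEq ι] [MeasurableSingletonClass Λ] [Fintype ι] in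
theorem measurable_pair (h : IsUniformFamily P π B) :
    Measurable fun ω => (B ω, fun r => π (φ r) ω) :=
  h.measurable_label.prodMk (measurable_pi_lambda _ fun r => h.measurable_perm (φ r))

omit [DecidableEq ι] in
theorem integrable (h : IsUniformFamily P π B) (φ : ι → PermIndex d q)
    (F : Λ → (ι → Equiv.Perm (Fin q)) → ℝ) :
    Integrable (fun ω => F (B ω) fun r => π (φ r) ω) P := by
  have : IsProbabilityMeasure (P.map fun ω => (B ω, fun r => π (φ r) ω)) :=
    Measure.isProbabilityMeasure_map h.measurable_pair.aemeasurable
  exact (Integrable.of_finite (μ := P.map fun ω => (B ω, fun r => π (φ r) ω))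
    (f := fun x => F x.1 x.2)).comp_measurable h.measurable_pair

/-- Expectations are averages over the labels and over all permutations. -/
theorem integral_eq (h : IsUniformFamily P π B) (hφ : Function.Injective φ)
    (F : Λ → (ι → Equiv.Perm (Fin q)) → ℝ) :
    ∫ ω, F (B ω) (fun r => π (φ r) ω) ∂P = ∑ β, P.real (B ⁻¹' {β}) *
      (((Fintype.card (ι → Equiv.Perm (Fin q)) : ℕ) : ℝ)⁻¹ * ∑ τ, F β τ) := by
  have hm := h.measurable_pair (φ := φ)
  have : IsProbabilityMeasure (P.map fun ω => (B ω, fun r => π (φ r) ω)) :=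
    Measure.isProbabilityMeasure_map hm.aemeasurable
  have h1 := integral_map (μ := P) hm.aemeasurable
    (f := fun x : Λ × (ι → Equiv.Perm (Fin q)) => F x.1 x.2)
    (measurable_of_finite _).aestronglyMeasurable
  rw [← h1, integral_fintype Integrable.of_finite, Fintype.sum_prod_type]
  refine Finset.sum_congr rfl fun β _ => ?_
  rw [Finset.mul_sum, Finset.mul_sum]
  refine Finset.sum_congr rfl fun τ _ => ?_
  rw [map_measureReal_apply hm (measurableSet_singleton _), h.measureReal_eq hφ, smul_eq_mul,
    mul_assoc]

/-- The bound is required only at labels that occur, since the distinctness of labels is known only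
there; other label values have an empty preimage. -/
theorem integral_le (h : IsUniformFamily P π B) (hφ : Function.Injective φ)
    (F : Λ → (ι → Equiv.Perm (Fin q)) → ℝ) {C : ℝ}
    (hF : ∀ ω, ∑ τ, F (B ω) τ ≤ Fintype.card (ι → Equiv.Perm (Fin q)) * C) :
    ∫ ω, F (B ω) (fun r => π (φ r) ω) ∂P ≤ C := by
  have hN : (0 : ℝ) < (Fintype.card (ι → Equiv.Perm (Fin q)) : ℕ) := by
    exact_mod_cast Fintype.card_pos
  have h1 := h.integral_eq hφ fun _ _ => C
  simp only [integral_const, probReal_univ, one_smul] at h1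
  rw [h.integral_eq hφ F, h1]
  refine Finset.sum_le_sum fun β _ => ?_
  by_cases hβ : ∃ ω, B ω = β
  · obtain ⟨ω, rfl⟩ := hβ
    refine mul_le_mul_of_nonneg_left ?_ measureReal_nonneg
    refine mul_le_mul_of_nonneg_left ?_ (inv_nonneg.2 hN.le)
    simpa using hF ω
  · have : B ⁻¹' {β} = ∅ := by
      ext ω
      simpa using fun hω => hβ ⟨ω, hω⟩
    simp [this]

theorem integral_eq_zero (h : IsUniformFamily P π B) (hφ : Function.Injective φ)
    (F : Λ → (ι → Equiv.Perm (Fin q)) → ℝ) (hF : ∀ ω, ∑ τ, F (B ω) τ = 0) :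
    ∫ ω, F (B ω) (fun r => π (φ r) ω) ∂P = 0 := by
  refine le_antisymm (h.integral_le hφ F fun ω => by simp [hF]) ?_
  have := h.integral_le hφ (fun β τ => - F β τ) (C := 0) fun ω => by simp [hF]
  rw [integral_neg] at this
  linarith

theorem sum_sumArrow {T : Type*} [Fintype T] [DecidableEq T]
    (F : (Fin d → Equiv.Perm (Fin q)) → (T → Equiv.Perm (Fin q)) → ℝ) :
    ∑ τ : Fin d ⊕ T → Equiv.Perm (Fin q), F (fun j => τ (.inl j)) (fun t => τ (.inr t)) =
      ∑ σ, ∑ ρ, F σ ρ := by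
  rw [← Fintype.sum_prod_type']
  exact Fintype.sum_equiv (Equiv.sumArrowEquivProdArrow _ _ _) _ _ fun τ => rfl

variable {T : Type*} [Fintype T] [DecidableEq T] {ψ : T → PermIndex d q}

/-- This plays the role of conditioning on the labels and the column permutations: a bound on the
average over the other permutations suffices. -/
theorem integral_column_le (h : IsUniformFamily P π B)
    (hψ : Function.Injective (Sum.elim PermIndex.column ψ))
    (F : Λ → (Fin d → Equiv.Perm (Fin q)) → (T → Equiv.Perm (Fin q)) → ℝ) {C : ℝ}
    (hF : ∀ ω σ, ∑ ρ, F (B ω) σ ρ ≤ Fintype.card (T → Equiv.Perm (Fin q)) * C) :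
    ∫ ω, F (B ω) (fun j => π (.column j) ω) (fun t => π (ψ t) ω) ∂P ≤ C := by
  refine h.integral_le hψ
    (fun β τ => F β (fun j => τ (.inl j)) (fun t => τ (.inr t))) fun ω => ?_
  rw [sum_sumArrow, Fintype.card_congr (Equiv.sumArrowEquivProdArrow _ _ _), Fintype.card_prod,
    Nat.cast_mul, mul_assoc, ← nsmul_eq_mul, ← Finset.card_univ, ← Finset.sum_const]
  exact Finset.sum_le_sum fun σ _ => hF ω σ

theorem integral_column_eq_zero (h : IsUniformFamily P π B)
    (hψ : Function.Injective (Sum.elim PermIndex.column ψ))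
    (F : Λ → (Fin d → Equiv.Perm (Fin q)) → (T → Equiv.Perm (Fin q)) → ℝ)
    (hF : ∀ ω σ, ∑ ρ, F (B ω) σ ρ = 0) :
    ∫ ω, F (B ω) (fun j => π (.column j) ω) (fun t => π (ψ t) ω) ∂P = 0 := by
  refine h.integral_eq_zero hψ
    (fun β τ => F β (fun j => τ (.inl j)) (fun t => τ (.inr t))) fun ω => ?_
  rw [sum_sumArrow]
  exact Finset.sum_eq_zero fun σ _ => hF ω σ

omit [DecidableEq T] in
theorem integrable_column (h : IsUniformFamily P π B) (ψ : T → PermIndex d q)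
    (F : Λ → (Fin d → Equiv.Perm (Fin q)) → (T → Equiv.Perm (Fin q)) → ℝ) :
    Integrable (fun ω => F (B ω) (fun j => π (.column j) ω) (fun t => π (ψ t) ω)) P :=
  h.integrable (Sum.elim PermIndex.column ψ)
    fun β τ => F β (fun j => τ (.inl j)) (fun t => τ (.inr t))

omit [Fintype Λ] [MeasurableSingletonClass Λ] in
/-- Almost surely, the digits of a coordinate are not eventually `q - 1`. -/
theorem ae_exists_digit [NeZero q] (h : IsUniformFamily P π B) (hq : 2 ≤ q) (i : Fin (q ^ 2))
    (j : Fin d) : ∀ᵐ ω ∂P, ∃ m, ((π (.digit i j (m + 1)) ω 0 : Fin q) : ℕ) + 1 < q := by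
  set g : ℕ → Ω → Equiv.Perm (Fin q) := fun m => π (.digit i j (m + 1)) with hg
  have hgi : iIndepFun g P := h.indep_perm.precomp (g := fun m => PermIndex.digit i j (m + 1))
    fun a b hab => by simpa using hab
  -- The crude event that the permutation is the identity already gives the digit `0 < q - 1`; by
  -- independence, it almost surely occurs for some `m`.
  set r : ENNReal := 1 - ((q.factorial : ENNReal))⁻¹ with hr
  have hone : ∀ m, P (g m ⁻¹' {1}ᶜ) = r := by
    intro m
    rw [Set.preimage_compl, prob_compl_eq_one_sub
      (h.measurable_perm _ MeasurableSpace.measurableSet_top)]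
    exact congrArg (1 - ·) (h.uniform_perm _ 1)
  have hr1 : r < 1 := by
    refine ENNReal.sub_lt_self ENNReal.one_ne_top one_ne_zero ?_
    simp
  have hle : ∀ N : ℕ, P (⋂ m, g m ⁻¹' {1}ᶜ) ≤ r ^ N := by
    intro N
    have h1 := hgi.measure_inter_preimage_eq_mul (Finset.range N) (sets := fun _ => {1}ᶜ)
      fun m _ => MeasurableSpace.measurableSet_top
    rw [Finset.prod_congr rfl fun m _ => hone m, Finset.prod_const, Finset.card_range] at h1
    rw [← h1]
    exact measure_mono fun ω hω => by
      simp only [Set.mem_iInter] at hω ⊢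
      exact fun m _ => hω m
  have hzero : P (⋂ m, g m ⁻¹' {1}ᶜ) = 0 :=
    le_antisymm (ge_of_tendsto' (ENNReal.tendsto_pow_atTop_nhds_zero_of_lt_one hr1) hle) zero_le
  rw [← compl_mem_ae_iff] at hzero
  filter_upwards [hzero] with ω hω
  simp only [Set.mem_compl_iff, Set.mem_iInter, Set.mem_preimage, Set.mem_singleton_iff,
    not_forall, not_not] at hω
  obtain ⟨m, hm⟩ := hω
  refine ⟨m, ?_⟩
  have : π (.digit i j (m + 1)) ω = 1 := hm
  rw [this]
  simpa using (by omega : 1 < q)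

end IsUniformFamily

end Law

/-! ### The common form of both designs and their error bounds -/

section Design

variable {d q : ℕ} [NeZero q] {Ω : Type*}

/-- The average of `f` over the points with the given digits. -/
def estimator (f : EuclideanSpace ℝ (Fin d) → ℝ) (dig : Ω → Fin (q ^ 2) → Fin d → ℕ → Fin q)
    (ω : Ω) : ℝ :=
  1 / (q : ℝ) ^ 2 * ∑ i, f (ofDigits (dig ω i))

/-- The mean over the box of two digits `σ j (A i j)`, `e j` minus the mean over the box of the
first digits. -/
def cellDeviation (f : EuclideanSpace ℝ (Fin d) → ℝ) (A : Matrix (Fin (q ^ 2)) (Fin d) (Fin q))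
    (σ : Fin d → Equiv.Perm (Fin q)) (i : Fin (q ^ 2)) (e : Fin d → Fin q) : ℝ :=
  boxMean f (1 + 1) (extendDigits 1 (fun j _ => σ j (A i j)) e) -
    boxMean f 1 fun j _ => σ j (A i j)

/-- The part of the estimator that the second digits contribute. -/
def secondDigitPart {T : Type*} (f : EuclideanSpace ℝ (Fin d) → ℝ)
    (A : Matrix (Fin (q ^ 2)) (Fin d) (Fin q)) (κ : Fin (q ^ 2) → Fin d → T)
    (β : Fin (q ^ 2) → Fin d → Fin q) (σ : Fin d → Equiv.Perm (Fin q))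
    (ρ : T → Equiv.Perm (Fin q)) : ℝ :=
  1 / (q : ℝ) ^ 2 * ∑ i, cellDeviation f A σ i (draw (κ i) (β i) ρ)

/-- A sampling design whose first digits randomize the array `A`, and whose second digits are
drawn from permutations `π (ψ t)` through the index map `κ` and the labels `B`. -/
structure IsDesign [MeasurableSpace Ω] {T : Type*} [Fintype T] [DecidableEq T] (P : Measure Ω)
    (A : Matrix (Fin (q ^ 2)) (Fin d) (Fin q)) (π : PermIndex d q → Ω → Equiv.Perm (Fin q))
    (B : Ω → Fin (q ^ 2) → Fin d → Fin q) (ψ : T → PermIndex d q) (κ : Fin (q ^ 2) → Fin d → T)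
    (dig : Ω → Fin (q ^ 2) → Fin d → ℕ → Fin q) : Prop where
  array : IsOrthogonalArray 2 A
  family : IsUniformFamily P π B
  injective : Function.Injective (Sum.elim PermIndex.column ψ)
  scheme : ∀ ω, IsDrawScheme κ (B ω)
  digit_zero : ∀ ω i j, dig ω i j 0 = π (.column j) ω (A i j)
  digit_one : ∀ ω i j, dig ω i j 1 = π (ψ (κ i j)) ω (B ω i j)
  digit_add_two : ∀ ω i j m, dig ω i j (m + 2) = π (.digit i j (m + 1)) ω 0

theorem sum_cellDeviation {f : EuclideanSpace ℝ (Fin d) → ℝ} (hf : IntegrableOn f (cube d))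
    (A : Matrix (Fin (q ^ 2)) (Fin d) (Fin q)) (σ : Fin d → Equiv.Perm (Fin q))
    (i : Fin (q ^ 2)) : ∑ e, cellDeviation f A σ i e = 0 := by
  simp only [cellDeviation]
  rw [Finset.sum_sub_distrib, sum_boxMean_extendDigits hf]
  simp

theorem abs_cellDeviation_le {f : EuclideanSpace ℝ (Fin d) → ℝ} {L : ℝ} (hL0 : 0 ≤ L)
    (hL : ∀ x ∈ cube d, ∀ y ∈ cube d, |f x - f y| ≤ L * ‖x - y‖)
    (A : Matrix (Fin (q ^ 2)) (Fin d) (Fin q)) (σ : Fin d → Equiv.Perm (Fin q))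
    (i : Fin (q ^ 2)) (e : Fin d → Fin q) :
    |cellDeviation f A σ i e| ≤ L * (√d * (q : ℝ)⁻¹) := by
  have h := abs_boxMean_sub_boxMean_le hL0 hL (m := 1) (n := 1 + 1) (by norm_num)
    (extendDigits 1 (fun j _ => σ j (A i j)) e)
  have h1 : boxMean f (fun _ => 1) (extendDigits 1 (fun j _ => σ j (A i j)) e) =
      boxMean f 1 fun j _ => σ j (A i j) :=
    boxMean_congr f fun j k hk => by
      have : k < 1 := hk
      simp [extendDigits, this]
  rw [h1, pow_one] at h
  exact h

/-- For each single row the permuted symbols are uniform on the grid, so no property of the array is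
needed; this centres the proxy. -/
theorem sum_boxMean_perm {f : EuclideanSpace ℝ (Fin d) → ℝ} (hf : IntegrableOn f (cube d))
    (A : Matrix (Fin (q ^ 2)) (Fin d) (Fin q)) :
    ∑ σ : Fin d → Equiv.Perm (Fin q),
      (∑ i, boxMean f 1 (fun j _ => σ j (A i j)) - (q : ℝ) ^ 2 * mean f) = 0 := by
  have h0 : ∑ e : Fin d → Fin q, (boxMean f 1 (fun j _ => e j) - mean f) = 0 := by
    have h := sum_boxMean_extendDigits hf 0 (fun _ _ => (0 : Fin q))
    rw [boxMean_zero, zero_add] at h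
    have h' : ∀ e : Fin d → Fin q, extendDigits 0 (fun _ _ => (0 : Fin q)) e = fun j _ => e j := by
      intro e
      funext j k
      simp [extendDigits]
    simp only [h'] at h
    rw [Finset.sum_sub_distrib, h]
    simp
  have h1 : ∀ σ : Fin d → Equiv.Perm (Fin q),
      ∑ i, boxMean f 1 (fun j _ => σ j (A i j)) - (q : ℝ) ^ 2 * mean f =
        ∑ i, (boxMean f 1 (fun j _ => σ j (A i j)) - mean f) := by
    intro σ
    rw [Finset.sum_sub_distrib]
    simp
  rw [Finset.sum_congr rfl fun σ _ => h1 σ, Finset.sum_comm]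
  exact Finset.sum_eq_zero fun i _ =>
    sum_draw_eq_zero id Function.injective_id (A i)
      (fun e => boxMean f 1 (fun j _ => e j) - mean f) h0

namespace IsDesign

variable [MeasurableSpace Ω] {T : Type*} [Fintype T] [DecidableEq T] {P : Measure Ω}
  [IsProbabilityMeasure P] {A : Matrix (Fin (q ^ 2)) (Fin d) (Fin q)}
  {π : PermIndex d q → Ω → Equiv.Perm (Fin q)} {B : Ω → Fin (q ^ 2) → Fin d → Fin q}
  {ψ : T → PermIndex d q} {κ : Fin (q ^ 2) → Fin d → T}
  {dig : Ω → Fin (q ^ 2) → Fin d → ℕ → Fin q} {f : EuclideanSpace ℝ (Fin d) → ℝ} {L : ℝ}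

omit [IsProbabilityMeasure P] in
theorem measurable_digit (h : IsDesign P A π B ψ κ dig) (i : Fin (q ^ 2)) (j : Fin d) (k : ℕ) :
    Measurable fun ω => dig ω i j k := by
  match k with
  | 0 =>
    simp only [h.digit_zero]
    exact (measurable_of_finite fun τ : Equiv.Perm (Fin q) => τ (A i j)).comp
      (h.family.measurable_perm _)
  | 1 =>
    simp only [h.digit_one]
    exact (measurable_of_finite fun x : (Fin (q ^ 2) → Fin d → Fin q) × Equiv.Perm (Fin q) =>
      x.2 (x.1 i j)).comp (h.family.measurable_label.prodMk (h.family.measurable_perm _))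
  | m + 2 =>
    simp only [h.digit_add_two]
    exact (measurable_of_finite fun τ : Equiv.Perm (Fin q) => τ 0).comp
      (h.family.measurable_perm _)

/-- The exceptional null set is where some digit tail consists of `q - 1` only and the point falls
on the excluded upper face. -/
theorem ae_mem_box (h : IsDesign P A π B ψ κ dig) (hq : 2 ≤ q) :
    ∀ᵐ ω ∂P, ∀ i, ofDigits (dig ω i) ∈ box (fun _ => 2) (dig ω i) := by
  have : ∀ᵐ ω ∂P, ∀ i j, ∃ m, ((π (.digit i j (m + 1)) ω 0 : Fin q) : ℕ) + 1 < q :=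
    ae_all_iff.2 fun i => ae_all_iff.2 fun j => h.family.ae_exists_digit hq i j
  filter_upwards [this] with ω hω i
  refine ofDigits_mem_box fun j => ?_
  obtain ⟨m, hm⟩ := hω i j
  exact ⟨m + 2, by omega, by rwa [h.digit_add_two]⟩

theorem aemeasurable_estimator (h : IsDesign P A π B ψ κ dig) (hq : 2 ≤ q)
    (hf : ContinuousOn f (cube d)) : AEMeasurable (estimator f dig) P := by
  classical
  -- Nothing is known about `f` off the cube, so it is replaced there by zero; the sample avoids
  -- that region almost surely.
  have hm : Measurable ((cube d).piecewise f 0) :=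
    hf.measurable_piecewise continuousOn_const (measurableSet_cube d)
  refine ⟨estimator ((cube d).piecewise f 0) dig, ?_, ?_⟩
  · exact (Finset.measurable_sum _ fun i _ =>
      hm.comp (measurable_ofDigits_comp fun j k => h.measurable_digit i j k)).const_mul _
  · filter_upwards [h.ae_mem_box hq] with ω hω
    simp only [estimator]
    congr 1
    exact Finset.sum_congr rfl fun i _ =>
      (Set.piecewise_eq_of_mem _ _ _ (box_subset_cube _ _ (hω i))).symm

omit [IsProbabilityMeasure P] in
theorem boxMean_two_eq (h : IsDesign P A π B ψ κ dig) (f : EuclideanSpace ℝ (Fin d) → ℝ)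
    (ω : Ω) (i : Fin (q ^ 2)) :
    boxMean f (fun _ => 2) (dig ω i) = boxMean f 1 (fun j _ => π (.column j) ω (A i j)) +
      cellDeviation f A (fun j => π (.column j) ω) i
        (draw (κ i) (B ω i) fun t => π (ψ t) ω) := by
  rw [cellDeviation, add_sub_cancel]
  refine boxMean_congr f fun j k hk => ?_
  have : k = 0 ∨ k = 1 := by omega
  rcases this with rfl | rfl
  · simp [extendDigits, h.digit_zero]
  · simp [extendDigits, h.digit_one, draw]

/-- Up to order `q⁻²`, the estimator is the mean plus the proxy plus the part contributed by the
second digits. -/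
theorem ae_abs_sub_le (h : IsDesign P A π B ψ κ dig) (hq : 2 ≤ q) (hL0 : 0 ≤ L)
    (hL : ∀ x ∈ cube d, ∀ y ∈ cube d, |f x - f y| ≤ L * ‖x - y‖) :
    ∀ᵐ ω ∂P, |estimator f dig ω - (mean f + 1 / (q : ℝ) ^ 2 * proxySum f A π ω +
      secondDigitPart f A κ (B ω) (fun j => π (.column j) ω) (fun t => π (ψ t) ω))| ≤
        L * (√d * ((q : ℝ) ^ 2)⁻¹) := by
  filter_upwards [h.ae_mem_box hq] with ω hω
  have hq0 : (0 : ℝ) < q := cast_base_pos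
  have h1 : mean f + 1 / (q : ℝ) ^ 2 * proxySum f A π ω +
      secondDigitPart f A κ (B ω) (fun j => π (.column j) ω) (fun t => π (ψ t) ω) =
      1 / (q : ℝ) ^ 2 * ∑ i, boxMean f (fun _ => 2) (dig ω i) := by
    rw [proxySum_eq (integrableOn_of_lipschitz hL0 hL) h.array, secondDigitPart]
    simp_rw [h.boxMean_two_eq]
    rw [Finset.sum_add_distrib]
    field_simp
    ring
  rw [h1, estimator, ← mul_sub, ← Finset.sum_sub_distrib, abs_mul,
    abs_of_nonneg (by positivity : (0 : ℝ) ≤ 1 / (q : ℝ) ^ 2)]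
  calc 1 / (q : ℝ) ^ 2 * |∑ i, (f (ofDigits (dig ω i)) - boxMean f (fun _ => 2) (dig ω i))|
      ≤ 1 / (q : ℝ) ^ 2 * ∑ _i : Fin (q ^ 2), L * (√d * ((q : ℝ) ^ 2)⁻¹) := by
        gcongr
        exact (Finset.abs_sum_le_sum_abs _ _).trans
          (Finset.sum_le_sum fun i _ => abs_sub_boxMean_le hL0 hL (hω i))
    _ = L * (√d * ((q : ℝ) ^ 2)⁻¹) := by
        simp
        field_simp

theorem integral_secondDigitPart (h : IsDesign P A π B ψ κ dig) (hf : IntegrableOn f (cube d)) :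
    ∫ ω, secondDigitPart f A κ (B ω) (fun j => π (.column j) ω) (fun t => π (ψ t) ω) ∂P = 0 := by
  refine h.family.integral_column_eq_zero h.injective (secondDigitPart f A κ) fun ω σ => ?_
  simp only [secondDigitPart]
  rw [← Finset.mul_sum, Finset.sum_comm, Finset.sum_eq_zero, mul_zero]
  exact fun i _ => sum_draw_eq_zero _ ((h.scheme ω).injective i) _ _ (sum_cellDeviation hf A σ i)

/-- Powers of `q`: the prefactor squared gives `q⁻⁴`, the number of rows `q²`, and the squared size
of a deviation `q⁻²`. -/
theorem integral_sq_secondDigitPart_le (h : IsDesign P A π B ψ κ dig) (hq : 2 ≤ q) (hL0 : 0 ≤ L)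
    (hL : ∀ x ∈ cube d, ∀ y ∈ cube d, |f x - f y| ≤ L * ‖x - y‖) :
    ∫ ω, secondDigitPart f A κ (B ω) (fun j => π (.column j) ω) (fun t => π (ψ t) ω) ^ 2 ∂P ≤
      (1 + d) * (L * √d) ^ 2 / (q : ℝ) ^ 4 := by
  have hq0 : (0 : ℝ) < q := cast_base_pos
  refine h.family.integral_column_le h.injective
    (fun β σ ρ => secondDigitPart f A κ β σ ρ ^ 2) fun ω σ => ?_
  simp only [secondDigitPart, mul_pow (1 / (q : ℝ) ^ 2)]
  rw [← Finset.mul_sum]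
  refine (mul_le_mul_of_nonneg_left ((h.scheme ω).sum_sq_le hq (cellDeviation f A σ)
    (sum_cellDeviation (integrableOn_of_lipschitz hL0 hL) A σ)
    (abs_cellDeviation_le hL0 hL A σ)) (by positivity)).trans (le_of_eq ?_)
  push_cast
  field_simp

theorem integral_proxySum (h : IsDesign P A π B ψ κ dig) (hf : IntegrableOn f (cube d)) :
    ∫ ω, proxySum f A π ω ∂P = 0 := by
  simp_rw [proxySum_eq hf h.array]
  exact h.family.integral_eq_zero (φ := PermIndex.column) (fun a b hab => by simpa using hab)
    (fun _ σ => ∑ i, boxMean f 1 (fun j _ => σ j (A i j)) - (q : ℝ) ^ 2 * mean f)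
    fun _ => sum_boxMean_perm hf A

theorem integrable_proxySum (h : IsDesign P A π B ψ κ dig) (hf : IntegrableOn f (cube d)) :
    Integrable (proxySum f A π) P := by
  have := h.family.integrable PermIndex.column fun _ σ =>
    ∑ i, boxMean f 1 (fun j _ => σ j (A i j)) - (q : ℝ) ^ 2 * mean f
  exact this.congr (Eventually.of_forall fun ω => (proxySum_eq hf h.array π ω).symm)

theorem integrable_sq_proxySum (h : IsDesign P A π B ψ κ dig) (hf : IntegrableOn f (cube d)) :
    Integrable (fun ω => (1 / (q : ℝ) ^ 2 * proxySum f A π ω) ^ 2) P := by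
  have := h.family.integrable PermIndex.column fun _ σ =>
    (1 / (q : ℝ) ^ 2 * (∑ i, boxMean f 1 (fun j _ => σ j (A i j)) - (q : ℝ) ^ 2 * mean f)) ^ 2
  exact this.congr (Eventually.of_forall fun ω => by simp only [proxySum_eq hf h.array π ω])

theorem memLp_estimator (h : IsDesign P A π B ψ κ dig) (hq : 2 ≤ q) (hL0 : 0 ≤ L)
    (hL : ∀ x ∈ cube d, ∀ y ∈ cube d, |f x - f y| ≤ L * ‖x - y‖) :
    MemLp (estimator f dig) 2 P := by
  have hq0 : (0 : ℝ) < q := cast_base_pos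
  refine MemLp.of_bound (h.aemeasurable_estimator hq
    (continuousOn_of_lipschitz hL)).aestronglyMeasurable (|f 0| + L * √d) ?_
  filter_upwards [h.ae_mem_box hq] with ω hω
  rw [Real.norm_eq_abs, estimator, abs_mul,
    abs_of_nonneg (by positivity : (0 : ℝ) ≤ 1 / (q : ℝ) ^ 2)]
  calc 1 / (q : ℝ) ^ 2 * |∑ i, f (ofDigits (dig ω i))|
      ≤ 1 / (q : ℝ) ^ 2 * ∑ _i : Fin (q ^ 2), (|f 0| + L * √d) := by
        gcongr
        exact (Finset.abs_sum_le_sum_abs _ _).trans (Finset.sum_le_sum fun i _ =>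
          abs_le_of_lipschitz hL0 hL (box_subset_cube _ _ (hω i)))
    _ = |f 0| + L * √d := by
        simp
        field_simp

/-- The proxy and the second-digit part are centred, so only the error of replacing `f` by box means
contributes to the bias. -/
theorem abs_integral_estimator_sub_le (h : IsDesign P A π B ψ κ dig) (hq : 2 ≤ q) (hL0 : 0 ≤ L)
    (hL : ∀ x ∈ cube d, ∀ y ∈ cube d, |f x - f y| ≤ L * ‖x - y‖) :
    |∫ ω, estimator f dig ω ∂P - mean f| ≤ L * (√d * ((q : ℝ) ^ 2)⁻¹) := by
  have hf := integrableOn_of_lipschitz hL0 hL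
  have hS := (h.integrable_proxySum hf).const_mul (1 / (q : ℝ) ^ 2)
  have hR := h.family.integrable_column ψ (secondDigitPart f A κ)
  have hM : Integrable (fun ω => mean f + 1 / (q : ℝ) ^ 2 * proxySum f A π ω) P :=
    (integrable_const _).add hS
  have h1 : ∫ ω, (mean f + 1 / (q : ℝ) ^ 2 * proxySum f A π ω +
      secondDigitPart f A κ (B ω) (fun j => π (.column j) ω) (fun t => π (ψ t) ω)) ∂P =
      mean f := by
    rw [integral_add hM hR, integral_add (integrable_const _) hS, integral_const_mul,
      h.integral_proxySum hf, h.integral_secondDigitPart hf]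
    simp
  have hE : Integrable (estimator f dig) P := (h.memLp_estimator hq hL0 hL).integrable one_le_two
  have hMR : Integrable (fun ω => mean f + 1 / (q : ℝ) ^ 2 * proxySum f A π ω +
      secondDigitPart f A κ (B ω) (fun j => π (.column j) ω) (fun t => π (ψ t) ω)) P := hM.add hR
  rw [← h1, ← integral_sub hE hMR]
  simp_rw [← Real.norm_eq_abs]
  refine (norm_integral_le_of_norm_le_const (C := L * (√d * ((q : ℝ) ^ 2)⁻¹)) ?_).trans
    (by simp)
  simpa only [Real.norm_eq_abs] using h.ae_abs_sub_le hq hL0 hL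

/-- Standardizing and rescaling the estimator changes its error by at most order `q⁻²`, also when
the variance vanishes. -/
theorem ae_abs_standardize_le (h : IsDesign P A π B ψ κ dig) (hq : 2 ≤ q) (hL0 : 0 ≤ L)
    (hL : ∀ x ∈ cube d, ∀ y ∈ cube d, |f x - f y| ≤ L * ‖x - y‖) :
    ∀ᵐ ω ∂P, |√(variance (estimator f dig) P) *
      ((estimator f dig ω - mean f) / √(variance (estimator f dig) P)) -
        (estimator f dig ω - mean f)| ≤ L * (√d * ((q : ℝ) ^ 2)⁻¹) := by
  by_cases hv : variance (estimator f dig) P = 0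
  · have hmem := h.memLp_estimator hq hL0 hL
    have h0 : evariance (estimator f dig) P = 0 := by
      rw [variance, ENNReal.toReal_eq_zero_iff] at hv
      exact hv.resolve_right hmem.evariance_lt_top.ne
    rw [evariance_eq_zero_iff hmem.aestronglyMeasurable.aemeasurable] at h0
    filter_upwards [h0] with ω hω
    -- With zero variance the estimator is almost surely its expectation, and the discarded term is
    -- the bias.
    rw [hv, hω, Real.sqrt_zero, zero_mul, zero_sub, abs_neg]
    exact h.abs_integral_estimator_sub_le hq hL0 hL
  · have hs : √(variance (estimator f dig) P) ≠ 0 :=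
      (Real.sqrt_pos.2 (lt_of_le_of_ne (variance_nonneg _ _) (Ne.symm hv))).ne'
    refine Eventually.of_forall fun ω => ?_
    rw [mul_div_cancel₀ _ hs, sub_self, abs_zero]
    positivity

/-- If `sigma` vanishes, so does the second moment of the proxy, hence the proxy itself almost
surely. -/
theorem ae_sigma_mul_WProxy (h : IsDesign P A π B ψ κ dig) (hf : IntegrableOn f (cube d)) :
    ∀ᵐ ω ∂P, sigma P f A π * WProxy P f A π ω = 1 / (q : ℝ) ^ 2 * proxySum f A π ω := by
  have hq0 : (0 : ℝ) < q := cast_base_pos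
  by_cases hs : sigma P f A π = 0
  · have h0 : ∫ ω, (1 / (q : ℝ) ^ 2 * proxySum f A π ω) ^ 2 ∂P = 0 :=
      le_antisymm (Real.sqrt_eq_zero'.1 hs) (integral_nonneg fun _ => sq_nonneg _)
    rw [integral_eq_zero_iff_of_nonneg (fun _ => sq_nonneg _) (h.integrable_sq_proxySum hf)] at h0
    filter_upwards [h0] with ω hω
    rw [hs, zero_mul]
    exact (pow_eq_zero_iff two_ne_zero |>.1 hω).symm
  · refine Eventually.of_forall fun ω => ?_
    rw [WProxy]
    field_simp

/-- The tail of the distance between the standardized estimator and its proxy. -/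
theorem measure_le_abs_le (h : IsDesign P A π B ψ κ dig) (hq : 2 ≤ q) (hL0 : 0 ≤ L)
    (hL : ∀ x ∈ cube d, ∀ y ∈ cube d, |f x - f y| ≤ L * ‖x - y‖) {ε : ℝ} (hε : 0 < ε)
    (hqε : 2 * (L * √d) / q ≤ ε / 2) :
    P {ω | ε ≤ |(q : ℝ) * (√(variance (estimator f dig) P) *
      ((estimator f dig ω - mean f) / √(variance (estimator f dig) P)) -
        sigma P f A π * WProxy P f A π ω)|} ≤
      ENNReal.ofReal ((1 + d) * (L * √d) ^ 2 / (ε / 2) ^ 2 / (q : ℝ) ^ 2) := by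
  have hq0 : (0 : ℝ) < q := cast_base_pos
  have hf := integrableOn_of_lipschitz hL0 hL
  set R : Ω → ℝ := fun ω =>
    secondDigitPart f A κ (B ω) (fun j => π (.column j) ω) (fun t => π (ψ t) ω) with hR
  -- The standardization and box-mean errors, `L * √d / q` each after scaling by `q`, use up at most
  -- `ε / 2`; the remaining `ε / 2` must come from `q * |R ω|`.
  have hsub : ∀ᵐ ω ∂P, ε ≤ |(q : ℝ) * (√(variance (estimator f dig) P) *
      ((estimator f dig ω - mean f) / √(variance (estimator f dig) P)) -
        sigma P f A π * WProxy P f A π ω)| → (ε / 2 / q) ^ 2 ≤ R ω ^ 2 := by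
    filter_upwards [h.ae_abs_standardize_le hq hL0 hL, h.ae_sigma_mul_WProxy hf,
      h.ae_abs_sub_le hq hL0 hL] with ω h1 h2 h3 h4
    rw [h2, abs_mul, abs_of_pos hq0] at h4
    set a := √(variance (estimator f dig) P) *
      ((estimator f dig ω - mean f) / √(variance (estimator f dig) P))
    rw [← sq_abs (R ω)]
    refine pow_le_pow_left₀ (by positivity) ?_ 2
    have h5 : |a - 1 / (q : ℝ) ^ 2 * proxySum f A π ω| ≤
        2 * (L * (√d * ((q : ℝ) ^ 2)⁻¹)) + |R ω| := by
      have : a - 1 / (q : ℝ) ^ 2 * proxySum f A π ω = (a - (estimator f dig ω - mean f)) +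
          (estimator f dig ω - (mean f + 1 / (q : ℝ) ^ 2 * proxySum f A π ω + R ω)) + R ω := by
        ring
      rw [this]
      refine (abs_add_three _ _ _).trans ?_
      linarith
    have h6 : (q : ℝ) * (2 * (L * (√d * ((q : ℝ) ^ 2)⁻¹))) ≤ ε / 2 := by
      refine le_trans (le_of_eq ?_) hqε
      field_simp
    have h7 := mul_le_mul_of_nonneg_left h5 hq0.le
    rw [div_le_iff₀ hq0]
    linarith
  have hint : Integrable (fun ω => R ω ^ 2) P :=
    h.family.integrable_column ψ fun β σ ρ => secondDigitPart f A κ β σ ρ ^ 2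
  have hmarkov := mul_meas_ge_le_integral_of_nonneg
    (Eventually.of_forall fun ω => sq_nonneg (R ω)) hint ((ε / 2 / q) ^ 2)
  have hle := hmarkov.trans (h.integral_sq_secondDigitPart_le hq hL0 hL)
  calc _ ≤ P {ω | (ε / 2 / q) ^ 2 ≤ R ω ^ 2} := measure_mono_ae hsub
    _ = ENNReal.ofReal (P.real {ω | (ε / 2 / q) ^ 2 ≤ R ω ^ 2}) := by
        rw [ofReal_measureReal]
    _ ≤ _ := by
        refine ENNReal.ofReal_le_ofReal ?_
        rw [← le_div_iff₀' (by positivity)] at hle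
        refine hle.trans (le_of_eq ?_)
        field_simp

end IsDesign

end Design

/-! ### The two sampling schemes as designs -/

section Instances

variable {d q : ℕ} [NeZero q] {Ω : Type*} [MeasurableSpace Ω] {P : Measure Ω}
  {A : Matrix (Fin (q ^ 2)) (Fin d) (Fin q)} {π : PermIndex d q → Ω → Equiv.Perm (Fin q)}
  {b : Ω → Fin (q ^ 2) → Fin d → Fin q}

/-- Second-digit permutations are indexed by column and symbol, so rows share one exactly where they
agree in `A`, which happens in at most one column. -/
theorem IsRandomization.isDesign_oal (h : IsRandomization P A π b) (hA : IsOrthogonalArray 2 A) :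
    IsDesign P A π b (fun t : Fin d × Fin q => .sub t.1 t.2) (fun i j => (j, A i j))
      (oalDigit A π b) where
  array := hA
  family := ⟨h.measurable_perm, h.uniform_perm, h.indep_perm, h.measurable_label, h.indep_label⟩
  injective := by
    rintro (a | ⟨a, s⟩) (a' | ⟨a', s'⟩) <;> simp
  scheme ω :=
    { injective := fun i j k hjk => congrArg Prod.fst hjk
      column_eq := fun i i' j j' hjj => congrArg Prod.fst hjj
      shared_unique := fun i i' j k hne hj hk => by
        by_contra hjk
        exact hne (hA.row_eq hjk (congrArg Prod.snd hj) (congrArg Prod.snd hk))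
      label_ne := fun i i' j hne hj hb =>
        hne (h.label_injective ω i i' j (congrArg Prod.snd hj) hb)
      card_shared_le := fun i j => by
        simpa using hA.card_agree_le i j }
  digit_zero _ _ _ := rfl
  digit_one _ _ _ := rfl
  digit_add_two _ _ _ _ := rfl

/-- Every second digit has its own permutation, evaluated at the constant label `0`; nothing is
shared, so the conditions on shared permutations are vacuous. -/
theorem IsRandomization.isDesign_oas [IsProbabilityMeasure P] (h : IsRandomization P A π b)
    (hA : IsOrthogonalArray 2 A) :
    IsDesign P A π (fun _ _ _ => 0) (fun t : Fin (q ^ 2) × Fin d => .digit t.1 t.2 0)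
      (fun i j => (i, j)) (oasDigit A π) where
  array := hA
  family := ⟨h.measurable_perm, h.uniform_perm, h.indep_perm, measurable_const,
    (indepFun_const_left _ _)⟩
  injective := by
    rintro (a | ⟨a, s⟩) (a' | ⟨a', s'⟩) <;> simp
  scheme ω :=
    { injective := fun i j k hjk => congrArg Prod.snd hjk
      column_eq := fun i i' j j' hjj => congrArg Prod.snd hjj
      shared_unique := fun i i' j k hne hj _ => absurd (congrArg Prod.fst hj) hne
      label_ne := fun i i' j hne hj => absurd (congrArg Prod.fst hj) hne
      card_shared_le := fun i j => by
        rw [Finset.card_eq_zero.2]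
        · exact Nat.zero_le _
        · rw [Finset.filter_eq_empty_iff]
          intro i' hi' hj
          exact Finset.ne_of_mem_erase hi' (congrArg Prod.fst hj).symm }
  digit_zero _ _ _ := rfl
  digit_one _ _ _ := rfl
  digit_add_two _ _ _ _ := rfl

end Instances

/-- Along designs with `q → ∞`, the standardized estimator is asymptotically equal to its proxy. -/
theorem tendstoZeroInProbability_of_isDesign {d : ℕ} {f : EuclideanSpace ℝ (Fin d) → ℝ} {L : ℝ}
    (hL0 : 0 ≤ L) (hL : ∀ x ∈ cube d, ∀ y ∈ cube d, |f x - f y| ≤ L * ‖x - y‖)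
    {q : ℕ → ℕ} [∀ n, NeZero (q n)] (hq : Tendsto q atTop atTop)
    {A : ∀ n, Matrix (Fin (q n ^ 2)) (Fin d) (Fin (q n))}
    {Ω : ℕ → Type*} [∀ n, MeasurableSpace (Ω n)]
    {P : ∀ n, Measure (Ω n)} [∀ n, IsProbabilityMeasure (P n)]
    {π : ∀ n, PermIndex d (q n) → Ω n → Equiv.Perm (Fin (q n))}
    {B : ∀ n, Ω n → Fin (q n ^ 2) → Fin d → Fin (q n)}
    {T : ℕ → Type*} [∀ n, Fintype (T n)] [∀ n, DecidableEq (T n)]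
    {ψ : ∀ n, T n → PermIndex d (q n)} {κ : ∀ n, Fin (q n ^ 2) → Fin d → T n}
    {dig : ∀ n, Ω n → Fin (q n ^ 2) → Fin d → ℕ → Fin (q n)}
    (h : ∀ n, IsDesign (P n) (A n) (π n) (B n) (ψ n) (κ n) (dig n)) :
    TendstoZeroInProbability P fun n ω =>
      (q n : ℝ) * (√(variance (estimator f (dig n)) (P n)) *
        ((estimator f (dig n) ω - mean f) / √(variance (estimator f (dig n)) (P n))) -
          sigma (P n) f (A n) (π n) * WProxy (P n) f (A n) (π n) ω) := by
  intro ε hε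
  have hqR : Tendsto (fun n => (q n : ℝ)) atTop atTop := tendsto_natCast_atTop_atTop.comp hq
  have hlim : Tendsto (fun n => ENNReal.ofReal
      ((1 + d) * (L * √d) ^ 2 / (ε / 2) ^ 2 / (q n : ℝ) ^ 2)) atTop (𝓝 0) := by
    rw [← ENNReal.ofReal_zero]
    exact ENNReal.tendsto_ofReal
      (((tendsto_pow_atTop two_ne_zero).comp hqR).const_div_atTop _)
  have hsmall : ∀ᶠ n in atTop, 2 * (L * √d) / q n ≤ ε / 2 :=
    (hqR.const_div_atTop (2 * (L * √d))).eventually_le_const (half_pos hε)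
  refine tendsto_of_tendsto_of_tendsto_of_le_of_le' tendsto_const_nhds hlim
    (Eventually.of_forall fun _ => zero_le) ?_
  filter_upwards [hsmall, hq.eventually_ge_atTop 2] with n h1 h2
  exact (h n).measure_le_abs_le h2 hL0 hL hε h1

end OASampling

end

theorem proposition2 {d : ℕ} (f : EuclideanSpace ℝ (Fin d) → ℝ)
    (hf : SmoothLipschitzMixedPartial f)
    (q : ℕ → ℕ) [∀ n, NeZero (q n)] (hq : Tendsto q atTop atTop)
    (A : ∀ n, Matrix (Fin (q n ^ 2)) (Fin d) (Fin (q n)))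
    (hA : ∀ n, IsOrthogonalArray 2 (A n))
    {Ω : ℕ → Type*} [∀ n, MeasurableSpace (Ω n)]
    (P : ∀ n, Measure (Ω n)) [∀ n, IsProbabilityMeasure (P n)]
    (π : ∀ n, PermIndex d (q n) → Ω n → Equiv.Perm (Fin (q n)))
    (b : ∀ n, Ω n → Fin (q n ^ 2) → Fin d → Fin (q n))
    (hπ : ∀ n, IsRandomization (P n) (A n) (π n) (b n)) :
    TendstoZeroInProbability P (fun n ω =>
        (q n : ℝ) * (sigmaOal (P n) f (A n) (π n) (b n) * WOal (P n) f (A n) (π n) (b n) ω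
          - sigma (P n) f (A n) (π n) * WProxy (P n) f (A n) (π n) ω)) ∧
      TendstoZeroInProbability P (fun n ω =>
        (q n : ℝ) * (sigmaOas (P n) f (A n) (π n) * WOas (P n) f (A n) (π n) ω
          - sigma (P n) f (A n) (π n) * WProxy (P n) f (A n) (π n) ω)) := by
  obtain ⟨L, hL0, hL⟩ := hf.exists_lipschitz (by have := (hA 0).1; omega)
  exact ⟨tendstoZeroInProbability_of_isDesign hL0 hL hq fun n => (hπ n).isDesign_oal (hA n),
    tendstoZeroInProbability_of_isDesign hL0 hL hq fun n => (hπ n).isDesign_oas (hA n)⟩
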